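/- Let $N\ge 4$ be an integer, $\kappa>0$, $\epsilon=\pm1$, and let $\Omega\subset\mathbb R^{N-1}$ be open and connected. Let $V$ be a smooth function and $\hat h$ a smooth metric (nondegenerate, of any signature) on $\Omega$ such that $$\hat g=\epsilon e^{2V(x)}dy^2+e^{-2V(x)}\hat h_{ij}dx^idx^j$$ is a vacuum solution, $R_{\mu\nu}[\hat g]=0$, on $\mathbb R\times\Omega$ (an orthogonal-symmetric vacuum solution with cosmological constant $\Lambda=0$; the seed). The minimally coupled Einstein-scalar field equations with potential $W$ are $R_{\mu\nu}[g]=\kappa\left(\partial_\mu\phi\,\partial_\nu\phi+\frac{2}{N-2}g_{\mu\nu}W(\phi)\right)$ and $\Box\phi=W'(\phi)$. A solution of class $\mathcal T_N^0$ with vanishing potential derived from the seed is a solution of these equations with $W=0$ on $J\times\Omega$, $J$ a nonempty open interval, of the form $$g=e^{2\mu(y)}\left(\epsilon e^{2\alpha V}dy^2+e^{-2\alpha V}e^{-2\delta V}\hat h_{ij}dx^idx^j\right),\qquad \phi=\sigma V(x)+\rho\,\mu(y),\qquad \delta=\frac{N-4}{N-3}(1-\alpha),$$ with real constants $\alpha,\sigma,\rho$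 and a smooth nonconstant function $\mu$ on $J$. For $\eta>0$ and signs $s=\pm1$, $\lambda=\pm\sqrt{N-1}$, put $$\alpha=\frac{s\lambda}{\sqrt{N-3+\lambda^2}},\quad \sigma=s\sqrt{\frac{N-2}{\kappa(N-3+\lambda^2)}},\quad \rho=\sqrt{\frac{N-2}{\kappa}}\,\lambda,\quad \gamma=\alpha+\frac{N-4}{N-3}(1-\alpha),$$ and consider, in coordinates $(Y,x)\in\mathbb R\times\Omega$, $$ds^2=\epsilon e^{2\alpha V+2\lambda^2\sqrt\eta\,Y}dY^2+e^{2\sqrt\eta\,Y}e^{-2\gamma V}\hat h_{ij}dx^idx^j,\qquad \phi=\sigma V(x)+\rho\sqrt\eta\,Y. \qquad(*)$$ (1) For all $\eta>0$ and all choices of the signs, $\alpha=\pm\sqrt{\frac12\frac{N-1}{N-2}}$ and $\sigma=s\sqrt{\frac{N-2}{\kappa(N-3)}(1-\alpha^2)}=\frac{s}{\sqrt{2\kappa}}$; the pair $(*)$ solves the Einstein-scalar field equations with $W=0$ on $\mathbb R\times\Omega$; and it is a solution of class $\mathcal T_N^0$ with these $\alpha,\sigma,\rho$, expressed in a new coordinate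 $Y=Y(y)$ whose range is $\mathbb R$. (2) Assume that $V$ is not constant or that $V$ is normalized to $V\equiv0$. Then for every solution of class $\mathcal T_N^0$ with vanishing potential derived from the seed there is exactly one $\eta>0$ such that, for some choice of the signs and some smooth change of coordinate $Y=Y(y)$ on $J$ (a diffeomorphism onto its image), the solution takes the form $(*)$, its constant $\rho$ being the one given above and, if $V$ is not constant, its constants $\alpha,\sigma$ being the ones given above. Thus these solutions form a one-parameter family, parametrized by $\eta>0$. -/

import Mathlib

open scoped ContDiff

noncomputable section

namespace EinsteinScalar

section Geometry

variable {ι : Type} [Fintype ι] [DecidableEq ι]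

/-- The partial derivative of a real function on a coordinate space. -/
def pd (i : ι) (f : (ι → ℝ) → ℝ) (p : ι → ℝ) : ℝ :=
  fderiv ℝ f p (Pi.single i 1)

/-- A smooth (pseudo-)Riemannian metric, of any signature, on a coordinate domain. -/
structure IsMetricOn (g : (ι → ℝ) → Matrix ι ι ℝ) (D : Set (ι → ℝ)) : Prop where
  smooth : ∀ i j, ContDiffOn ℝ ∞ (fun p => g p i j) D
  symm : ∀ p ∈ D, ∀ i j, g p i j = g p j i
  nondegenerate : ∀ p ∈ D, (g p).det ≠ 0

/-- Christoffel symbols `Γ^k_{ij}` of the Levi-Civita connection. -/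
def christoffel (g : (ι → ℝ) → Matrix ι ι ℝ) (k i j : ι) (p : ι → ℝ) : ℝ :=
  (1 / 2) * ∑ l, (g p)⁻¹ k l *
    (pd i (fun q => g q j l) p + pd j (fun q => g q i l) p - pd l (fun q => g q i j) p)

/-- The Ricci tensor `R_{ij} = ∂_k Γ^k_{ij} - ∂_j Γ^k_{ik} + Γ^k_{kl} Γ^l_{ij} - Γ^k_{jl} Γ^l_{ik}`
(round spheres have positive Ricci curvature). -/
def ricci (g : (ι → ℝ) → Matrix ι ι ℝ) (i j : ι) (p : ι → ℝ) : ℝ :=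
  (∑ k, (pd k (christoffel g k i j) p - pd j (christoffel g k i k) p)) +
    ∑ k, ∑ l, (christoffel g k k l p * christoffel g l i j p
      - christoffel g k j l p * christoffel g l i k p)

/-- The Laplace-Beltrami (d'Alembert) operator `g^{ij} ∇_i ∇_j φ`. -/
def box (g : (ι → ℝ) → Matrix ι ι ℝ) (φ : (ι → ℝ) → ℝ) (p : ι → ℝ) : ℝ :=
  ∑ i, ∑ j, (g p)⁻¹ i j *
    (pd i (pd j φ) p - ∑ k, christoffel g k i j p * pd k φ p)

/-- Vacuum Einstein equations with cosmological constant `Λ` in dimension `N = card ι`: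
`R_{ij} = 2 / (N - 2) * Λ * g_{ij}`. -/
structure IsVacuumSolution (Λ : ℝ) (g : (ι → ℝ) → Matrix ι ι ℝ) (D : Set (ι → ℝ)) : Prop where
  metric : IsMetricOn g D
  einstein : ∀ p ∈ D, ∀ i j, ricci g i j p = 2 / ((Fintype.card ι : ℝ) - 2) * Λ * g p i j

/-- Minimally coupled Einstein-scalar field equations with effective potential `W`
in dimension `N = card ι`:
`R_{ij} = κ (∂_i φ ∂_j φ + 2 / (N - 2) g_{ij} W(φ))` and `□ φ - W'(φ) = 0`. -/
structure IsEinsteinScalarSolution (κ : ℝ) (W : ℝ → ℝ) (g : (ι → ℝ) → Matrix ι ι ℝ)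
    (φ : (ι → ℝ) → ℝ) (D : Set (ι → ℝ)) : Prop where
  metric : IsMetricOn g D
  field_smooth : ContDiffOn ℝ ∞ φ D
  einstein : ∀ p ∈ D, ∀ i j, ricci g i j p =
    κ * (pd i φ p * pd j φ p + 2 / ((Fintype.card ι : ℝ) - 2) * g p i j * W (φ p))
  scalar : ∀ p ∈ D, box g φ p - deriv W (φ p) = 0

/-- The pullback of a metric by a coordinate transformation. -/
def pullbackMetric (F : (ι → ℝ) → (ι → ℝ)) (g : (ι → ℝ) → Matrix ι ι ℝ) (p : ι → ℝ) :
    Matrix ι ι ℝ :=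
  Matrix.of fun i j => ∑ a, ∑ b,
    pd i (fun q => F q a) p * pd j (fun q => F q b) p * g (F p) a b

end Geometry

/-! Spacetime coordinates are `p : Fin (n + 1) → ℝ`, with `p 0` the coordinate `y` (or `Y`) and
`Fin.tail p` the coordinates `x` on the `n = N - 1` dimensional hypersurfaces. -/

variable {n : ℕ}

/-- The line element `A dy² + B_{ij} dx^i dx^j`. -/
def blockMetric (A : ℝ) (B : Matrix (Fin n) (Fin n) ℝ) : Matrix (Fin (n + 1)) (Fin (n + 1)) ℝ :=
  Matrix.of fun a b =>
    Fin.cases (Fin.cases A (fun _ => 0) b) (fun i => Fin.cases 0 (fun j => B i j) b) a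

/-- The coordinate domain `J × Ω`. -/
def slab (J : Set ℝ) (Ω : Set (Fin n → ℝ)) : Set (Fin (n + 1) → ℝ) :=
  {p | p 0 ∈ J ∧ Fin.tail p ∈ Ω}

/-- The orthogonal-symmetric metric `g[U, h] = ε e^{2U(x)} dy² + e^{-2U(x)} h_{ij} dx^i dx^j`. -/
def orthSymMetric (ε : ℝ) (U : (Fin n → ℝ) → ℝ) (h : (Fin n → ℝ) → Matrix (Fin n) (Fin n) ℝ)
    (p : Fin (n + 1) → ℝ) : Matrix (Fin (n + 1)) (Fin (n + 1)) ℝ :=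
  blockMetric (ε * Real.exp (2 * U (Fin.tail p)))
    (Real.exp (-2 * U (Fin.tail p)) • h (Fin.tail p))

/-- A seed: an orthogonal-symmetric vacuum solution `g[V, hhat]` with cosmological constant `Λ`. -/
structure IsSeed (ε Λ : ℝ) (Ω : Set (Fin n → ℝ)) (V : (Fin n → ℝ) → ℝ)
    (hhat : (Fin n → ℝ) → Matrix (Fin n) (Fin n) ℝ) : Prop where
  smooth : ContDiffOn ℝ ∞ V Ω
  metric : IsMetricOn hhat Ω
  vacuum : IsVacuumSolution Λ (orthSymMetric ε V hhat) (slab Set.univ Ω)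

/-- The exponent `δ = (N - 4) / (N - 3) * (1 - α)` of the conformal factor relating the metrics
`hhat = e^{2 δ V} h` of the hypersurfaces. -/
def deltaOf (N α : ℝ) : ℝ := (N - 4) / (N - 3) * (1 - α)

/-- `γ = α + (N - 4) / (N - 3) * (1 - α)`. -/
def gammaOf (N α : ℝ) : ℝ := α + (N - 4) / (N - 3) * (1 - α)

/-- The conformally y-inflated metric `e^{2μ(y)} g[αV, e^{-2δV} hhat]`. -/
def inflatedMetric (ε α δ : ℝ) (V : (Fin n → ℝ) → ℝ)
    (hhat : (Fin n → ℝ) → Matrix (Fin n) (Fin n) ℝ) (μ : ℝ → ℝ)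
    (p : Fin (n + 1) → ℝ) : Matrix (Fin (n + 1)) (Fin (n + 1)) ℝ :=
  Real.exp (2 * μ (p 0)) •
    orthSymMetric ε (fun x => α * V x) (fun x => Real.exp (-2 * (δ * V x)) • hhat x) p

/-- The scalar field `σ V(x) + ρ μ(y)`. -/
def inflatedField (σ ρ : ℝ) (V : (Fin n → ℝ) → ℝ) (μ : ℝ → ℝ) (p : Fin (n + 1) → ℝ) : ℝ :=
  σ * V (Fin.tail p) + ρ * μ (p 0)

/-- Solutions of class `T_N^0` with scalar potential `W`: the conformally y-inflated solutions
of the Einstein-scalar field equations on `J × Ω`, with nonconstant `μ`, that are derived from an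
orthogonal-symmetric vacuum solution with vanishing cosmological constant. -/
structure IsClassTZero (κ ε : ℝ) (W : ℝ → ℝ) (Ω : Set (Fin n → ℝ)) (V : (Fin n → ℝ) → ℝ)
    (hhat : (Fin n → ℝ) → Matrix (Fin n) (Fin n) ℝ) (J : Set ℝ) (μ : ℝ → ℝ) (α σ ρ : ℝ) :
    Prop where
  seed : IsSeed ε 0 Ω V hhat
  isOpen : IsOpen J
  interval : J.OrdConnected
  nonempty : J.Nonempty
  smooth : ContDiffOn ℝ ∞ μ J
  nonconstant : ¬ ∃ c, ∀ y ∈ J, μ y = c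
  solution : IsEinsteinScalarSolution κ W
    (inflatedMetric ε α (deltaOf ((n : ℝ) + 1) α) V hhat μ) (inflatedField σ ρ V μ) (slab J Ω)

/-- `α` in terms of `λ` and the sign `s`. -/
def alphaOf (N lam s : ℝ) : ℝ := s * (lam / √(N - 3 + lam ^ 2))

/-- `σ` in terms of `λ` and the sign `s`. -/
def sigmaOf (N κ lam s : ℝ) : ℝ := s * √((N - 2) / (κ * (N - 3 + lam ^ 2)))

/-- `ρ` in terms of `λ`. -/
def rhoOf (N κ lam : ℝ) : ℝ := √((N - 2) / κ) * lam

/-- The metric `ε e^{2αV + 2λ²√η Y} dY² + e^{2√η Y} e^{-2γV} hhat_{ij} dx^i dx^j`. -/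
def familyMetric (N ε η lam α : ℝ) (V : (Fin n → ℝ) → ℝ)
    (hhat : (Fin n → ℝ) → Matrix (Fin n) (Fin n) ℝ) (p : Fin (n + 1) → ℝ) :
    Matrix (Fin (n + 1)) (Fin (n + 1)) ℝ :=
  blockMetric (ε * Real.exp (2 * α * V (Fin.tail p) + 2 * lam ^ 2 * √η * p 0))
    ((Real.exp (2 * √η * p 0) * Real.exp (-2 * gammaOf N α * V (Fin.tail p))) • hhat (Fin.tail p))

/-- The scalar field `σ V(x) + ρ √η Y`. -/
def familyField (η σ ρ : ℝ) (V : (Fin n → ℝ) → ℝ) (p : Fin (n + 1) → ℝ) : ℝ :=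
  σ * V (Fin.tail p) + ρ * √η * p 0

/-- `y ↦ Y y` is an admissible change of coordinate on `J`: a diffeomorphism onto its image. -/
structure IsCoordChange (Y : ℝ → ℝ) (J : Set ℝ) : Prop where
  smooth : ContDiffOn ℝ ∞ Y J
  deriv_ne : ∀ y ∈ J, deriv Y y ≠ 0
  inj : Set.InjOn Y J

/-- The coordinate transformation `(y, x) ↦ (Y y, x)`. -/
def reparam (Y : ℝ → ℝ) (p : Fin (n + 1) → ℝ) : Fin (n + 1) → ℝ :=
  Fin.cons (Y (p 0)) (Fin.tail p)

/-- On `J × Ω`, the change of coordinate `y ↦ Y y` carries the conformally y-inflated metric and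
field to the metric `g` and the scalar field `φ` in the coordinates `(Y, x)`. -/
structure Reexpresses (ε : ℝ) (Ω : Set (Fin n → ℝ)) (V : (Fin n → ℝ) → ℝ)
    (hhat : (Fin n → ℝ) → Matrix (Fin n) (Fin n) ℝ) (J : Set ℝ) (μ : ℝ → ℝ) (α σ ρ : ℝ)
    (Y : ℝ → ℝ) (g : (Fin (n + 1) → ℝ) → Matrix (Fin (n + 1)) (Fin (n + 1)) ℝ)
    (φ : (Fin (n + 1) → ℝ) → ℝ) : Prop where
  coord : IsCoordChange Y J
  metric : ∀ p ∈ slab J Ω,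
    inflatedMetric ε α (deltaOf ((n : ℝ) + 1) α) V hhat μ p = pullbackMetric (reparam Y) g p
  field : ∀ p ∈ slab J Ω, inflatedField σ ρ V μ p = φ (reparam Y p)

end EinsteinScalar

end

/-! The seed, the inflated metric and the family `(*)` are all warped metrics `ε e^{2(P(y) + αV)}
dy² + e^{2(q(y) - γV)} h`, with `h` the seed's spatial metric. One curvature computation therefore
serves all three. For the seed (`α = γ = 1`, `P = q = 0`) it gives `□V = (n - 3)|∇V|²` and expresses
`Ric h` through the Hessian of `V` and `dV ⊗ dV`, where `n = N - 1`. The exponent `δ` is chosen so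
that `(n - 2)γ = α + n - 3`. With this relation the Hessian and `□V` drop out of the field
equations, leaving equations in `y` and multiples of `dV` and `dV ⊗ dV`
(`isEinsteinScalarSolution_warpedMetric_iff`).

For `P = q = μ`, the spatial equation equates a nonzero multiple of `(μ'' + (n - 1)μ'²) h` with a
multiple of `dV ⊗ dV`. The latter has rank at most one and `h` is nondegenerate, so `μ'' = -(n -
1)μ'²` (`deriv_deriv_of_isClassTZero`). Hence `μ' e^{(n-1)μ}` is a constant `m`, nonzero because `μ`
is not constant. The `dy²` equation then gives `κρ² = n(n - 1)`. Where `dV` does not vanish, the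
mixed and spatial equations fix `α` and `σ` up to sign (`AreFamilyConstants.exists_sign`).

With `η = m²` and `Y = μ/√η` the first integral turns `e^{2μ} dy²` into `e^{2n√η Y} dY²`, which is
the family (`reexpresses_of_deriv_mul_exp`). Conversely the spatial block of any such representation
forces `μ = √η Y`, and the `dy²` block then forces `η = m²` (`eq_of_reexpresses`). For part (1), the
family satisfies the reduced equations directly, and a logarithmic `μ` on the half-line realizes
every `η` with `Y` ranging over `ℝ` (`exists_isClassTZero`). -/

noncomputable section

namespace EinsteinScalar

set_option linter.unusedSectionVars false

/-! ### Partial derivatives and smoothness. -/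

section Calculus

variable {ι : Type} [Fintype ι] [DecidableEq ι]

/-- `f` is differentiable at `p`, with `i`-th partial derivative `c`. -/
def HasPd (i : ι) (f : (ι → ℝ) → ℝ) (c : ℝ) (p : ι → ℝ) : Prop :=
  DifferentiableAt ℝ f p ∧ pd i f p = c

namespace HasPd

variable {i : ι} {f g : (ι → ℝ) → ℝ} {c d : ℝ} {p : ι → ℝ}

theorem of_differentiableAt (hf : DifferentiableAt ℝ f p) : HasPd i f (pd i f p) p :=
  ⟨hf, rfl⟩

theorem of_contDiffOn {D : Set (ι → ℝ)} (hD : IsOpen D) (hf : ContDiffOn ℝ ∞ f D) (hp : p ∈ D) :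
    HasPd i f (pd i f p) p :=
  of_differentiableAt ((hf.contDiffAt (hD.mem_nhds hp)).differentiableAt (by simp))

theorem const (a : ℝ) : HasPd i (fun _ => a) 0 p :=
  ⟨differentiableAt_const a, by simp [pd]⟩

theorem add (hf : HasPd i f c p) (hg : HasPd i g d p) : HasPd i (fun q => f q + g q) (c + d) p :=
  ⟨hf.1.fun_add hg.1, by rw [← hf.2, ← hg.2]; simp [pd, fderiv_fun_add hf.1 hg.1]⟩

theorem sub (hf : HasPd i f c p) (hg : HasPd i g d p) : HasPd i (fun q => f q - g q) (c - d) p :=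
  ⟨hf.1.fun_sub hg.1, by rw [← hf.2, ← hg.2]; simp [pd, fderiv_fun_sub hf.1 hg.1]⟩

theorem neg (hf : HasPd i f c p) : HasPd i (fun q => -f q) (-c) p :=
  ⟨hf.1.fun_neg, by rw [← hf.2]; simp [pd]⟩

theorem mul (hf : HasPd i f c p) (hg : HasPd i g d p) :
    HasPd i (fun q => f q * g q) (c * g p + f p * d) p :=
  ⟨hf.1.fun_mul hg.1, by
    rw [← hf.2, ← hg.2]; simp [pd, fderiv_fun_mul hf.1 hg.1]; ring⟩

theorem const_mul (a : ℝ) (hf : HasPd i f c p) : HasPd i (fun q => a * f q) (a * c) p := by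
  simpa using (HasPd.const a).mul hf

theorem exp (hf : HasPd i f c p) : HasPd i (fun q => Real.exp (f q)) (Real.exp (f p) * c) p :=
  ⟨hf.1.exp, by rw [← hf.2]; simp [pd, fderiv_exp hf.1]⟩

theorem sum {κ : Type} (s : Finset κ) {F : κ → (ι → ℝ) → ℝ} {C : κ → ℝ}
    (h : ∀ k ∈ s, HasPd i (F k) (C k) p) :
    HasPd i (fun q => ∑ k ∈ s, F k q) (∑ k ∈ s, C k) p := by
  refine ⟨DifferentiableAt.fun_sum fun k hk => (h k hk).1, ?_⟩
  rw [Finset.sum_congr rfl fun k hk => (h k hk).2.symm]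
  simp [pd, fderiv_fun_sum fun k hk => (h k hk).1]

theorem congr {D : Set (ι → ℝ)} (hD : IsOpen D) (hp : p ∈ D) (hf : HasPd i f c p)
    (hfg : ∀ q ∈ D, g q = f q) : HasPd i g c p := by
  have h : g =ᶠ[nhds p] f := Filter.eventually_of_mem (hD.mem_nhds hp) hfg
  exact ⟨hf.1.congr_of_eventuallyEq h, by rw [pd, h.fderiv_eq]; exact hf.2⟩

end HasPd

theorem contDiffOn_pd {f : (ι → ℝ) → ℝ} {D : Set (ι → ℝ)} (hD : IsOpen D)
    (hf : ContDiffOn ℝ ∞ f D) (i : ι) : ContDiffOn ℝ ∞ (pd i f) D :=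
  (hf.fderiv_of_isOpen hD (m := ∞) (by simp)).clm_apply contDiffOn_const

theorem pd_comm {f : (ι → ℝ) → ℝ} {D : Set (ι → ℝ)} (hD : IsOpen D)
    (hf : ContDiffOn ℝ ∞ f D) {p : ι → ℝ} (hp : p ∈ D) (i j : ι) :
    pd i (pd j f) p = pd j (pd i f) p := by
  have hfp := hf.contDiffAt (hD.mem_nhds hp)
  have hs : IsSymmSndFDerivAt ℝ f p := hfp.isSymmSndFDerivAt (by
    rw [minSmoothness_of_isRCLikeNormedField]; exact WithTop.coe_le_coe.2 (le_top : (2 : ℕ∞) ≤ ⊤))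
  have hd : DifferentiableAt ℝ (fderiv ℝ f) p :=
    (hfp.fderiv_right (m := ∞) (by simp)).differentiableAt (by simp)
  have key : ∀ a b : ι, pd a (pd b f) p
      = fderiv ℝ (fderiv ℝ f) p (Pi.single a 1) (Pi.single b 1) := by
    intro a b
    unfold pd
    rw [fderiv_clm_apply hd (differentiableAt_const _)]
    simp
  rw [key, key, hs]

/-- Through its contrapositive, a nonconstant `V` has a nonzero partial derivative somewhere, so
that `dV` can be cancelled from the field equations. -/
theorem exists_eq_const_of_pd_eq_zero {f : (ι → ℝ) → ℝ} {D : Set (ι → ℝ)} (hD : IsOpen D)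
    (hc : IsPreconnected D) (hf : ContDiffOn ℝ ∞ f D) (h : ∀ x ∈ D, ∀ i, pd i f x = 0) :
    ∃ c, ∀ x ∈ D, f x = c := by
  refine hD.exists_is_const_of_fderiv_eq_zero hc (hf.differentiableOn (by simp)) ?_
  intro x hx
  have hx' := h x hx
  simp only [pd] at hx'
  refine ContinuousLinearMap.ext fun v => ?_
  rw [← Finset.univ_sum_single v, map_sum]
  refine (Finset.sum_eq_zero fun i _ => ?_).trans (by simp)
  have : Pi.single i (v i) = v i • (Pi.single i 1 : ι → ℝ) := by simp [← Pi.single_smul]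
  rw [this, map_smul, hx', smul_zero]

/-- Cramer's rule: an adjugate entry is the determinant of `g` with one row made constant, hence
polynomial in the entries of `g`. -/
theorem contDiffOn_inv_apply {g : (ι → ℝ) → Matrix ι ι ℝ} {D : Set (ι → ℝ)}
    (hg : IsMetricOn g D) (i j : ι) : ContDiffOn ℝ ∞ (fun p => (g p)⁻¹ i j) D := by
  have hdet : ∀ {A : (ι → ℝ) → Matrix ι ι ℝ}, (∀ i j, ContDiffOn ℝ ∞ (fun p => A p i j) D) →
      ContDiffOn ℝ ∞ (fun p => (A p).det) D := by
    intro A hA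
    simp only [Matrix.det_apply']
    exact ContDiffOn.sum fun σ _ => contDiffOn_const.mul (contDiffOn_prod fun k _ => hA _ _)
  have : (fun p => (g p)⁻¹ i j) = fun p => ((g p).det)⁻¹ * (g p).adjugate i j := by
    ext p; simp [Matrix.inv_def]
  rw [this]
  refine ((hdet hg.smooth).inv hg.nondegenerate).mul ?_
  simp only [Matrix.adjugate_apply]
  refine hdet fun a b => ?_
  by_cases ha : a = j
  · subst ha; simp [Matrix.updateRow_self, contDiffOn_const]
  · simpa [Matrix.updateRow_ne ha] using hg.smooth a b

theorem contDiffOn_christoffel {g : (ι → ℝ) → Matrix ι ι ℝ} {D : Set (ι → ℝ)} (hD : IsOpen D)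
    (hg : IsMetricOn g D) (k i j : ι) : ContDiffOn ℝ ∞ (christoffel g k i j) D := by
  unfold christoffel
  refine contDiffOn_const.mul (ContDiffOn.sum fun l _ => (contDiffOn_inv_apply hg k l).mul ?_)
  exact ((contDiffOn_pd hD (hg.smooth _ _) _).add (contDiffOn_pd hD (hg.smooth _ _) _)).sub
    (contDiffOn_pd hD (hg.smooth _ _) _)

end Calculus

/-! ### The Levi-Civita connection, gradients and the Laplace-Beltrami operator. -/

section MetricIdentities

variable {ι : Type} [Fintype ι] [DecidableEq ι] {g : (ι → ℝ) → Matrix ι ι ℝ} {D : Set (ι → ℝ)}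

theorem pd_congr {f f' : (ι → ℝ) → ℝ} (hD : IsOpen D) {p : ι → ℝ} (hp : p ∈ D)
    (h : ∀ q ∈ D, f q = f' q) (i : ι) : pd i f p = pd i f' p := by
  have h' : f =ᶠ[nhds p] f' := Filter.eventually_of_mem (hD.mem_nhds hp) h
  rw [pd, h'.fderiv_eq, pd]

theorem IsMetricOn.pd_symm (hg : IsMetricOn g D) (hD : IsOpen D) {p : ι → ℝ} (hp : p ∈ D)
    (k i j : ι) : pd k (fun q => g q i j) p = pd k (fun q => g q j i) p :=
  pd_congr hD hp (fun q hq => hg.symm q hq i j) k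

theorem christoffel_symm (hg : IsMetricOn g D) (hD : IsOpen D) {p : ι → ℝ} (hp : p ∈ D)
    (k i j : ι) : christoffel g k i j p = christoffel g k j i p := by
  unfold christoffel
  congr 1
  refine Finset.sum_congr rfl fun l _ => ?_
  rw [hg.pd_symm hD hp l i j]
  ring

theorem IsMetricOn.sum_mul_inv (hg : IsMetricOn g D) {p : ι → ℝ} (hp : p ∈ D) (i j : ι) :
    ∑ k, g p i k * (g p)⁻¹ k j = if i = j then 1 else 0 := by
  rw [← Matrix.mul_apply, Matrix.mul_nonsing_inv _ (hg.nondegenerate p hp).isUnit,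
    Matrix.one_apply]

theorem IsMetricOn.sum_inv_mul (hg : IsMetricOn g D) {p : ι → ℝ} (hp : p ∈ D) (i j : ι) :
    ∑ k, (g p)⁻¹ i k * g p k j = if i = j then 1 else 0 := by
  rw [← Matrix.mul_apply, Matrix.nonsing_inv_mul _ (hg.nondegenerate p hp).isUnit,
    Matrix.one_apply]

/-- Lowering the upper index of the Christoffel symbols. -/
theorem sum_metric_mul_christoffel (hg : IsMetricOn g D) {p : ι → ℝ} (hp : p ∈ D) (m i j : ι) :
    ∑ k, g p m k * christoffel g k i j p =
      1 / 2 * (pd i (fun q => g q j m) p + pd j (fun q => g q i m) p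
        - pd m (fun q => g q i j) p) := by
  simp only [christoffel, Finset.mul_sum]
  rw [Finset.sum_comm]
  have : ∀ l, ∑ k, g p m k * (1 / 2 * ((g p)⁻¹ k l * (pd i (fun q => g q j l) p
      + pd j (fun q => g q i l) p - pd l (fun q => g q i j) p)))
      = (if m = l then 1 else 0) * (1 / 2 * (pd i (fun q => g q j l) p
      + pd j (fun q => g q i l) p - pd l (fun q => g q i j) p)) := by
    intro l
    rw [← hg.sum_mul_inv hp, Finset.sum_mul]
    exact Finset.sum_congr rfl fun k _ => by ring
  simp only [this]
  simp

/-- Metric compatibility of the Levi-Civita connection. -/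
theorem pd_metric (hg : IsMetricOn g D) (hD : IsOpen D) {p : ι → ℝ} (hp : p ∈ D) (k i j : ι) :
    pd k (fun q => g q i j) p =
      ∑ l, g p j l * christoffel g l k i p + ∑ l, g p i l * christoffel g l k j p := by
  rw [sum_metric_mul_christoffel hg hp, sum_metric_mul_christoffel hg hp,
    hg.pd_symm hD hp k j i, hg.pd_symm hD hp i k j, hg.pd_symm hD hp j k i]
  ring

/-- The gradient of a function with respect to a metric. -/
def grad (g : (ι → ℝ) → Matrix ι ι ℝ) (f : (ι → ℝ) → ℝ) (k : ι) (p : ι → ℝ) : ℝ :=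
  ∑ l, (g p)⁻¹ k l * pd l f p

/-- The squared norm of the gradient. -/
def gradSq (g : (ι → ℝ) → Matrix ι ι ℝ) (f : (ι → ℝ) → ℝ) (p : ι → ℝ) : ℝ :=
  ∑ k, pd k f p * grad g f k p

theorem contDiffOn_grad {f : (ι → ℝ) → ℝ} (hD : IsOpen D) (hg : IsMetricOn g D)
    (hf : ContDiffOn ℝ ∞ f D) (k : ι) : ContDiffOn ℝ ∞ (grad g f k) D :=
  ContDiffOn.sum fun l _ => (contDiffOn_inv_apply hg k l).mul (contDiffOn_pd hD hf l)

theorem sum_metric_mul_grad (hg : IsMetricOn g D) (f : (ι → ℝ) → ℝ) {p : ι → ℝ} (hp : p ∈ D)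
    (i : ι) : ∑ k, g p i k * grad g f k p = pd i f p := by
  simp only [grad, Finset.mul_sum]
  rw [Finset.sum_comm]
  simp only [← mul_assoc, ← Finset.sum_mul, hg.sum_mul_inv hp]
  simp

/-- Differentiate the lowered identity `∂_i f = g_{il} ∇^l f`; the inverse metric is then never
differentiated. -/
theorem pd_pd_eq_sum {f : (ι → ℝ) → ℝ} (hD : IsOpen D) (hg : IsMetricOn g D)
    (hf : ContDiffOn ℝ ∞ f D) {p : ι → ℝ} (hp : p ∈ D) (i k : ι) :
    pd k (pd i f) p = ∑ l, (pd k (fun q => g q i l) p * grad g f l p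
      + g p i l * pd k (grad g f l) p) := by
  have := HasPd.sum Finset.univ fun l (_ : l ∈ Finset.univ) =>
    (HasPd.of_contDiffOn (i := k) hD (hg.smooth i l) hp).mul
      (HasPd.of_contDiffOn (i := k) hD (contDiffOn_grad hD hg hf l) hp)
  rw [← this.2]
  exact pd_congr hD hp (fun q hq => (sum_metric_mul_grad hg f hq i).symm) k

/-- The divergence of the gradient is the Laplace-Beltrami operator. -/
theorem sum_pd_grad {f : (ι → ℝ) → ℝ} (hD : IsOpen D) (hg : IsMetricOn g D)
    (hf : ContDiffOn ℝ ∞ f D) {p : ι → ℝ} (hp : p ∈ D) :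
    ∑ k, pd k (grad g f k) p
      + ∑ k, ∑ l, christoffel g k k l p * grad g f l p = box g f p := by
  have h1 := fun i k => pd_pd_eq_sum hD hg hf hp i k
  -- Solve `h1` for the derivative of the gradient by raising the index.
  have h2 : ∀ k, pd k (grad g f k) p = ∑ i, (g p)⁻¹ k i * (pd k (pd i f) p
      - ∑ l, pd k (fun q => g q i l) p * grad g f l p) := by
    intro k
    have : ∀ i, pd k (pd i f) p - ∑ l, pd k (fun q => g q i l) p * grad g f l p
        = ∑ l, g p i l * pd k (grad g f l) p := by
      intro i; rw [h1, Finset.sum_add_distrib]; ring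
    simp only [this, Finset.mul_sum]
    rw [Finset.sum_comm]
    simp only [← mul_assoc, ← Finset.sum_mul, hg.sum_inv_mul hp]
    simp
  -- Metric compatibility splits this into the Christoffel term of the Hessian and a term that
  -- becomes the connection part of the divergence once its index is raised (`h4`).
  have h3 : ∀ k i, ∑ l, pd k (fun q => g q i l) p * grad g f l p
      = ∑ m, christoffel g m k i p * pd m f p
        + ∑ m, g p i m * ∑ l, christoffel g m k l p * grad g f l p := by
    intro k i
    simp only [pd_metric hg hD hp, add_mul, Finset.sum_add_distrib, Finset.sum_mul, Finset.mul_sum]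
    congr 1
    · rw [Finset.sum_comm]
      refine Finset.sum_congr rfl fun m _ => ?_
      rw [← sum_metric_mul_grad hg f hp m, Finset.mul_sum]
      refine Finset.sum_congr rfl fun l _ => ?_
      rw [hg.symm p hp l m]; ring
    · rw [Finset.sum_comm]
      exact Finset.sum_congr rfl fun m _ => Finset.sum_congr rfl fun l _ => by ring
  have h4 : ∀ k, ∑ i, (g p)⁻¹ k i * ∑ m, g p i m * ∑ l, christoffel g m k l p * grad g f l p
      = ∑ l, christoffel g k k l p * grad g f l p := by
    intro k
    change _ = (fun m => ∑ l, christoffel g m k l p * grad g f l p) k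
    change ∑ i, (g p)⁻¹ k i * ∑ m, g p i m * (fun m => ∑ l, christoffel g m k l p * grad g f l p) m
      = _
    generalize (fun m => ∑ l, christoffel g m k l p * grad g f l p) = F
    have : ∀ i, (g p)⁻¹ k i * ∑ m, g p i m * F m = ∑ m, (g p)⁻¹ k i * g p i m * F m := fun i => by
      rw [Finset.mul_sum]; exact Finset.sum_congr rfl fun m _ => by ring
    simp only [this]
    rw [Finset.sum_comm]
    simp only [← Finset.sum_mul, hg.sum_inv_mul hp]
    simp
  rw [← Finset.sum_add_distrib, box]
  refine Finset.sum_congr rfl fun k _ => ?_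
  rw [← h4, h2, ← Finset.sum_add_distrib]
  refine Finset.sum_congr rfl fun i _ => ?_
  rw [h3]
  ring

end MetricIdentities

/-! ### Functions of `y` alone and of `x` alone on `J × Ω`. -/

section Product

variable {n : ℕ} {p : Fin (n + 1) → ℝ}

theorem HasPd.zero_comp_zero {f : ℝ → ℝ} {c : ℝ} (hf : HasDerivAt f c (p 0)) :
    HasPd 0 (fun q : Fin (n + 1) → ℝ => f (q 0)) c p := by
  have h := hf.comp_hasFDerivAt p (ContinuousLinearMap.proj (R := ℝ) (φ := fun _ => ℝ)
    (0 : Fin (n + 1))).hasFDerivAt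
  refine ⟨h.differentiableAt, ?_⟩
  have h' := h.fderiv
  simp only [Function.comp_def, ContinuousLinearMap.proj_apply] at h'
  rw [pd, h']; simp

theorem HasPd.succ_comp_zero {f : ℝ → ℝ} (i : Fin n) (hf : DifferentiableAt ℝ f (p 0)) :
    HasPd i.succ (fun q : Fin (n + 1) → ℝ => f (q 0)) 0 p := by
  have h := hf.hasDerivAt.comp_hasFDerivAt p (ContinuousLinearMap.proj (R := ℝ) (φ := fun _ => ℝ)
    (0 : Fin (n + 1))).hasFDerivAt
  refine ⟨h.differentiableAt, ?_⟩
  have h' := h.fderiv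
  simp only [Function.comp_def, ContinuousLinearMap.proj_apply] at h'
  rw [pd, h']; simp

theorem hasFDerivAt_tail : HasFDerivAt (fun q : Fin (n + 1) → ℝ => (Fin.tail q : Fin n → ℝ))
    (ContinuousLinearMap.pi fun i : Fin n =>
      ContinuousLinearMap.proj (R := ℝ) (φ := fun _ => ℝ) i.succ) p :=
  (ContinuousLinearMap.pi fun i : Fin n =>
      ContinuousLinearMap.proj (R := ℝ) (φ := fun _ : Fin (n + 1) => ℝ) i.succ).hasFDerivAt

theorem HasPd.zero_comp_tail {f : (Fin n → ℝ) → ℝ} (hf : DifferentiableAt ℝ f (Fin.tail p)) :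
    HasPd 0 (fun q : Fin (n + 1) → ℝ => f (Fin.tail q)) 0 p := by
  have h := hf.hasFDerivAt.comp p hasFDerivAt_tail
  refine ⟨h.differentiableAt, ?_⟩
  have h' := h.fderiv
  simp only [Function.comp_def] at h'
  rw [pd, h', ContinuousLinearMap.comp_apply]
  have hz : (ContinuousLinearMap.pi fun i : Fin n =>
      ContinuousLinearMap.proj (R := ℝ) (φ := fun _ : Fin (n + 1) => ℝ) i.succ) (Pi.single 0 1)
      = 0 := by
    ext i; simp
  rw [hz, map_zero]

theorem HasPd.succ_comp_tail {f : (Fin n → ℝ) → ℝ} {c : ℝ} {i : Fin n}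
    (hf : HasPd i f c (Fin.tail p)) :
    HasPd i.succ (fun q : Fin (n + 1) → ℝ => f (Fin.tail q)) c p := by
  have h := hf.1.hasFDerivAt.comp p hasFDerivAt_tail
  refine ⟨h.differentiableAt, ?_⟩
  have h' := h.fderiv
  simp only [Function.comp_def] at h'
  rw [pd, h', ContinuousLinearMap.comp_apply, ← hf.2, pd]
  congr 1
  ext j; simp [Pi.single_apply]

theorem isOpen_slab {J : Set ℝ} {Ω : Set (Fin n → ℝ)} (hJ : IsOpen J) (hΩ : IsOpen Ω) :
    IsOpen (slab J Ω) :=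
  (hJ.preimage (continuous_apply 0)).inter
    (hΩ.preimage (continuous_pi fun i => continuous_apply i.succ))

theorem contDiffOn_comp_zero {J : Set ℝ} {Ω : Set (Fin n → ℝ)} {f : ℝ → ℝ}
    (hf : ContDiffOn ℝ ∞ f J) :
    ContDiffOn ℝ ∞ (fun q : Fin (n + 1) → ℝ => f (q 0)) (slab J Ω) :=
  hf.comp (contDiff_apply ℝ ℝ 0).contDiffOn fun _ hp => hp.1

theorem contDiffOn_comp_tail {J : Set ℝ} {Ω : Set (Fin n → ℝ)} {f : (Fin n → ℝ) → ℝ}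
    (hf : ContDiffOn ℝ ∞ f Ω) :
    ContDiffOn ℝ ∞ (fun q : Fin (n + 1) → ℝ => f (Fin.tail q)) (slab J Ω) :=
  hf.comp (contDiff_pi.2 fun i : Fin n =>
    contDiff_apply ℝ ℝ (i.succ : Fin (n + 1))).contDiffOn fun _ hp => hp.2

end Product

/-! ### Algebra of block-diagonal metrics. -/

section Block

variable {n : ℕ}

theorem blockMetric_mul (A A' : ℝ) (B B' : Matrix (Fin n) (Fin n) ℝ) :
    blockMetric A B * blockMetric A' B' = blockMetric (A * A') (B * B') := by
  ext i j
  rw [Matrix.mul_apply, Fin.sum_univ_succ]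
  refine Fin.cases ?_ (fun i => ?_) i <;> refine Fin.cases ?_ (fun j => ?_) j <;>
    simp [blockMetric, Matrix.mul_apply]

theorem blockMetric_one : blockMetric 1 (1 : Matrix (Fin n) (Fin n) ℝ) = 1 := by
  ext i j
  refine Fin.cases ?_ (fun i => ?_) i <;> refine Fin.cases ?_ (fun j => ?_) j <;>
    simp [blockMetric, Matrix.one_apply]
  exact (Fin.succ_ne_zero j).symm

theorem blockMetric_mul_inv {A c : ℝ} {B : Matrix (Fin n) (Fin n) ℝ} (hA : A ≠ 0) (hc : c ≠ 0)
    (hB : B.det ≠ 0) : blockMetric A (c • B) * blockMetric A⁻¹ (c⁻¹ • B⁻¹) = 1 := by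
  rw [blockMetric_mul, mul_inv_cancel₀ hA, smul_mul_smul_comm, mul_inv_cancel₀ hc, one_smul,
    Matrix.mul_nonsing_inv _ hB.isUnit, blockMetric_one]

end Block

/-! ### Warped metrics and their Christoffel symbols. -/

/-- The metric `ε e^{2(P(y) + αV(x))} dy² + e^{2(q(y) - γV(x))} h_{ij} dx^i dx^j`. -/
def warpedMetric {n : ℕ} (ε α γ : ℝ) (V : (Fin n → ℝ) → ℝ)
    (h : (Fin n → ℝ) → Matrix (Fin n) (Fin n) ℝ) (P q : ℝ → ℝ) (p : Fin (n + 1) → ℝ) :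
    Matrix (Fin (n + 1)) (Fin (n + 1)) ℝ :=
  blockMetric (ε * Real.exp (2 * (P (p 0) + α * V (Fin.tail p))))
    (Real.exp (2 * (q (p 0) - γ * V (Fin.tail p))) • h (Fin.tail p))

/-- Regularity of the data of a warped metric. -/
structure IsWarpedData {n : ℕ} (ε : ℝ) (Ω : Set (Fin n → ℝ)) (J : Set ℝ) (V : (Fin n → ℝ) → ℝ)
    (h : (Fin n → ℝ) → Matrix (Fin n) (Fin n) ℝ) (P q : ℝ → ℝ) : Prop where
  sign : ε * ε = 1
  openΩ : IsOpen Ω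
  openJ : IsOpen J
  smoothV : ContDiffOn ℝ ∞ V Ω
  metric : IsMetricOn h Ω
  smoothP : ContDiffOn ℝ ∞ P J
  smoothq : ContDiffOn ℝ ∞ q J

namespace IsWarpedData

variable {n : ℕ} {ε : ℝ} {Ω : Set (Fin n → ℝ)} {J : Set ℝ} {V : (Fin n → ℝ) → ℝ}
  {h : (Fin n → ℝ) → Matrix (Fin n) (Fin n) ℝ} {P q : ℝ → ℝ}
  (α γ : ℝ) {p : Fin (n + 1) → ℝ}

theorem sign_ne (H : IsWarpedData ε Ω J V h P q) : ε ≠ 0 := left_ne_zero_of_mul_eq_one H.sign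

theorem isOpen_slab (H : IsWarpedData ε Ω J V h P q) : IsOpen (slab J Ω) := EinsteinScalar.isOpen_slab H.openJ H.openΩ

theorem isMetricOn (H : IsWarpedData ε Ω J V h P q) : IsMetricOn (warpedMetric ε α γ V h P q) (slab J Ω) where
  smooth i j := by
    have hV := contDiffOn_comp_tail (J := J) H.smoothV
    have hP := contDiffOn_comp_zero (Ω := Ω) H.smoothP
    have hq := contDiffOn_comp_zero (Ω := Ω) H.smoothq
    refine Fin.cases ?_ (fun i => ?_) i <;> refine Fin.cases ?_ (fun j => ?_) j
    · exact contDiffOn_const.mul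
        (contDiffOn_const.mul (hP.add (contDiffOn_const.mul hV))).exp
    · exact contDiffOn_const
    · exact contDiffOn_const
    · exact (contDiffOn_const.mul (hq.sub (contDiffOn_const.mul hV))).exp.mul
        (contDiffOn_comp_tail (H.metric.smooth i j))
  symm p hp i j := by
    refine Fin.cases ?_ (fun i => ?_) i <;> refine Fin.cases ?_ (fun j => ?_) j <;>
      simp [warpedMetric, blockMetric, H.metric.symm _ hp.2]
  nondegenerate p hp :=
    (Matrix.isUnit_det_of_right_inverse (blockMetric_mul_inv
      (mul_ne_zero H.sign_ne (Real.exp_ne_zero _)) (Real.exp_ne_zero _)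
      (H.metric.nondegenerate _ hp.2))).ne_zero

/-- The sign `ε` appears uninverted because `ε² = 1`. -/
theorem inv_warpedMetric (H : IsWarpedData ε Ω J V h P q)
    (hp : p ∈ slab J Ω) : (warpedMetric ε α γ V h P q p)⁻¹ =
    blockMetric (ε * Real.exp (-(2 * (P (p 0) + α * V (Fin.tail p)))))
      (Real.exp (-(2 * (q (p 0) - γ * V (Fin.tail p)))) • (h (Fin.tail p))⁻¹) := by
  rw [warpedMetric, Matrix.inv_eq_right_inv (blockMetric_mul_inv
      (mul_ne_zero H.sign_ne (Real.exp_ne_zero _)) (Real.exp_ne_zero _)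
      (H.metric.nondegenerate _ hp.2)), Real.exp_neg, Real.exp_neg, mul_inv,
      inv_eq_of_mul_eq_one_right H.sign]

theorem hasPd_zero_P (H : IsWarpedData ε Ω J V h P q)
    (hp : p ∈ slab J Ω) : HasPd 0 (fun r : Fin (n + 1) → ℝ => P (r 0)) (deriv P (p 0)) p :=
  HasPd.zero_comp_zero ((H.smoothP.contDiffAt (H.openJ.mem_nhds hp.1)).differentiableAt
    (by simp)).hasDerivAt

theorem hasPd_succ_P (H : IsWarpedData ε Ω J V h P q)
    (hp : p ∈ slab J Ω) (k : Fin n) : HasPd k.succ (fun r : Fin (n + 1) → ℝ => P (r 0)) 0 p :=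
  HasPd.succ_comp_zero k ((H.smoothP.contDiffAt (H.openJ.mem_nhds hp.1)).differentiableAt
    (by simp))

theorem hasPd_zero_q (H : IsWarpedData ε Ω J V h P q)
    (hp : p ∈ slab J Ω) : HasPd 0 (fun r : Fin (n + 1) → ℝ => q (r 0)) (deriv q (p 0)) p :=
  HasPd.zero_comp_zero ((H.smoothq.contDiffAt (H.openJ.mem_nhds hp.1)).differentiableAt
    (by simp)).hasDerivAt

theorem hasPd_succ_q (H : IsWarpedData ε Ω J V h P q)
    (hp : p ∈ slab J Ω) (k : Fin n) : HasPd k.succ (fun r : Fin (n + 1) → ℝ => q (r 0)) 0 p :=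
  HasPd.succ_comp_zero k ((H.smoothq.contDiffAt (H.openJ.mem_nhds hp.1)).differentiableAt
    (by simp))

theorem contDiffOn_deriv_P (H : IsWarpedData ε Ω J V h P q) : ContDiffOn ℝ ∞ (deriv P) J :=
  H.smoothP.deriv_of_isOpen H.openJ (by simp)

theorem contDiffOn_deriv_q (H : IsWarpedData ε Ω J V h P q) : ContDiffOn ℝ ∞ (deriv q) J :=
  H.smoothq.deriv_of_isOpen H.openJ (by simp)

theorem hasPd_zero_dq (H : IsWarpedData ε Ω J V h P q)
    (hp : p ∈ slab J Ω) :
    HasPd 0 (fun r : Fin (n + 1) → ℝ => deriv q (r 0)) (deriv (deriv q) (p 0)) p :=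
  HasPd.zero_comp_zero ((H.contDiffOn_deriv_q.contDiffAt (H.openJ.mem_nhds hp.1)).differentiableAt
    (by simp)).hasDerivAt

theorem hasPd_succ_dq (H : IsWarpedData ε Ω J V h P q)
    (hp : p ∈ slab J Ω) (k : Fin n) :
    HasPd k.succ (fun r : Fin (n + 1) → ℝ => deriv q (r 0)) 0 p :=
  HasPd.succ_comp_zero k ((H.contDiffOn_deriv_q.contDiffAt (H.openJ.mem_nhds hp.1)).differentiableAt
    (by simp))

theorem hasPd_succ_dP (H : IsWarpedData ε Ω J V h P q)
    (hp : p ∈ slab J Ω) (k : Fin n) :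
    HasPd k.succ (fun r : Fin (n + 1) → ℝ => deriv P (r 0)) 0 p :=
  HasPd.succ_comp_zero k ((H.contDiffOn_deriv_P.contDiffAt (H.openJ.mem_nhds hp.1)).differentiableAt
    (by simp))

theorem hasPd_zero_tail (H : IsWarpedData ε Ω J V h P q)
    (hp : p ∈ slab J Ω) {f : (Fin n → ℝ) → ℝ} (hf : ContDiffOn ℝ ∞ f Ω) :
    HasPd 0 (fun r : Fin (n + 1) → ℝ => f (Fin.tail r)) 0 p :=
  HasPd.zero_comp_tail ((hf.contDiffAt (H.openΩ.mem_nhds hp.2)).differentiableAt (by simp))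

theorem hasPd_succ_tail (H : IsWarpedData ε Ω J V h P q)
    (hp : p ∈ slab J Ω) {f : (Fin n → ℝ) → ℝ} (hf : ContDiffOn ℝ ∞ f Ω) (k : Fin n) :
    HasPd k.succ (fun r : Fin (n + 1) → ℝ => f (Fin.tail r)) (pd k f (Fin.tail p)) p :=
  HasPd.succ_comp_tail (HasPd.of_contDiffOn H.openΩ hf hp.2)

theorem pd_zero_metric_zero_zero (H : IsWarpedData ε Ω J V h P q)
    (hp : p ∈ slab J Ω) :
    pd 0 (fun r => warpedMetric ε α γ V h P q r 0 0) p =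
      2 * deriv P (p 0) * (ε * Real.exp (2 * (P (p 0) + α * V (Fin.tail p)))) := by
  have := ((((H.hasPd_zero_P hp).add ((H.hasPd_zero_tail hp H.smoothV).const_mul α)).const_mul
    2).exp.const_mul ε).2
  refine Eq.trans this ?_
  ring

theorem pd_succ_metric_zero_zero (H : IsWarpedData ε Ω J V h P q)
    (hp : p ∈ slab J Ω) (k : Fin n) :
    pd k.succ (fun r => warpedMetric ε α γ V h P q r 0 0) p =
      2 * (α * pd k V (Fin.tail p)) *
        (ε * Real.exp (2 * (P (p 0) + α * V (Fin.tail p)))) := by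
  have := ((((H.hasPd_succ_P hp k).add ((H.hasPd_succ_tail hp H.smoothV k).const_mul α)).const_mul
    2).exp.const_mul ε).2
  refine Eq.trans this ?_
  ring

theorem pd_metric_zero_succ (k : Fin (n + 1)) (i : Fin n) :
    pd k (fun r => warpedMetric ε α γ V h P q r 0 i.succ) p = 0 :=
  (HasPd.const (i := k) (p := p) 0).2

theorem pd_metric_succ_zero (k : Fin (n + 1)) (i : Fin n) :
    pd k (fun r => warpedMetric ε α γ V h P q r i.succ 0) p = 0 :=
  (HasPd.const (i := k) (p := p) 0).2

theorem pd_zero_metric_succ_succ (H : IsWarpedData ε Ω J V h P q)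
    (hp : p ∈ slab J Ω) (i j : Fin n) :
    pd 0 (fun r => warpedMetric ε α γ V h P q r i.succ j.succ) p =
      Real.exp (2 * (q (p 0) - γ * V (Fin.tail p))) *
        (2 * deriv q (p 0) * h (Fin.tail p) i j) := by
  have := ((((H.hasPd_zero_q hp).sub ((H.hasPd_zero_tail hp H.smoothV).const_mul γ)).const_mul
    2).exp.mul (H.hasPd_zero_tail hp (H.metric.smooth i j))).2
  refine Eq.trans this ?_
  ring

theorem pd_succ_metric_succ_succ (H : IsWarpedData ε Ω J V h P q)
    (hp : p ∈ slab J Ω) (k i j : Fin n) :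
    pd k.succ (fun r => warpedMetric ε α γ V h P q r i.succ j.succ) p =
      Real.exp (2 * (q (p 0) - γ * V (Fin.tail p))) *
        (pd k (fun x => h x i j) (Fin.tail p)
          - 2 * γ * pd k V (Fin.tail p) * h (Fin.tail p) i j) := by
  have := ((((H.hasPd_succ_q hp k).sub ((H.hasPd_succ_tail hp H.smoothV k).const_mul γ)).const_mul
    2).exp.mul (H.hasPd_succ_tail hp (H.metric.smooth i j) k)).2
  refine Eq.trans this ?_
  ring

theorem blockMetric_zero_zero (A : ℝ) (B : Matrix (Fin n) (Fin n) ℝ) :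
    blockMetric A B 0 0 = A := rfl

theorem blockMetric_zero_succ (A : ℝ) (B : Matrix (Fin n) (Fin n) ℝ) (i : Fin n) :
    blockMetric A B 0 i.succ = 0 := rfl

theorem blockMetric_succ_zero (A : ℝ) (B : Matrix (Fin n) (Fin n) ℝ) (i : Fin n) :
    blockMetric A B i.succ 0 = 0 := rfl

theorem blockMetric_succ_succ (A : ℝ) (B : Matrix (Fin n) (Fin n) ℝ) (i j : Fin n) :
    blockMetric A B i.succ j.succ = B i j := rfl

theorem christoffel_zero (H : IsWarpedData ε Ω J V h P q)
    (hp : p ∈ slab J Ω) (i j : Fin (n + 1)) :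
    christoffel (warpedMetric ε α γ V h P q) 0 i j p =
      1 / 2 * (ε * Real.exp (-(2 * (P (p 0) + α * V (Fin.tail p))))) *
        (pd i (fun r => warpedMetric ε α γ V h P q r j 0) p
          + pd j (fun r => warpedMetric ε α γ V h P q r i 0) p
          - pd 0 (fun r => warpedMetric ε α γ V h P q r i j) p) := by
  rw [christoffel, Fin.sum_univ_succ, H.inv_warpedMetric α γ hp]
  simp only [blockMetric_zero_zero, blockMetric_zero_succ, zero_mul, Finset.sum_const_zero]
  ring

theorem christoffel_succ (H : IsWarpedData ε Ω J V h P q)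
    (hp : p ∈ slab J Ω) (k : Fin n) (i j : Fin (n + 1)) :
    christoffel (warpedMetric ε α γ V h P q) k.succ i j p =
      1 / 2 * ∑ l : Fin n,
        Real.exp (-(2 * (q (p 0) - γ * V (Fin.tail p)))) * (h (Fin.tail p))⁻¹ k l *
        (pd i (fun r => warpedMetric ε α γ V h P q r j l.succ) p
          + pd j (fun r => warpedMetric ε α γ V h P q r i l.succ) p
          - pd l.succ (fun r => warpedMetric ε α γ V h P q r i j) p) := by
  rw [christoffel, Fin.sum_univ_succ, H.inv_warpedMetric α γ hp]
  simp only [blockMetric_succ_zero, blockMetric_succ_succ, zero_mul, Matrix.smul_apply,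
    smul_eq_mul, zero_add]

theorem christoffel_zero_zero_zero (H : IsWarpedData ε Ω J V h P q)
    (hp : p ∈ slab J Ω) :
    christoffel (warpedMetric ε α γ V h P q) 0 0 0 p = deriv P (p 0) := by
  rw [H.christoffel_zero α γ hp, H.pd_zero_metric_zero_zero α γ hp, Real.exp_neg]
  have h1 := mul_inv_cancel₀ (Real.exp_ne_zero (2 * (P (p 0) + α * V (Fin.tail p))))
  linear_combination deriv P (p 0) * ε * ε * h1 + deriv P (p 0) * H.sign

theorem christoffel_zero_zero_succ (H : IsWarpedData ε Ω J V h P q)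
    (hp : p ∈ slab J Ω) (i : Fin n) :
    christoffel (warpedMetric ε α γ V h P q) 0 0 i.succ p = α * pd i V (Fin.tail p) := by
  rw [H.christoffel_zero α γ hp, pd_metric_succ_zero, H.pd_succ_metric_zero_zero α γ hp,
    pd_metric_zero_succ, Real.exp_neg]
  have h1 := mul_inv_cancel₀ (Real.exp_ne_zero (2 * (P (p 0) + α * V (Fin.tail p))))
  linear_combination (α * pd i V (Fin.tail p)) * ε * ε * h1 + (α * pd i V (Fin.tail p)) * H.sign

theorem christoffel_zero_succ_succ (H : IsWarpedData ε Ω J V h P q)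
    (hp : p ∈ slab J Ω) (i j : Fin n) :
    christoffel (warpedMetric ε α γ V h P q) 0 i.succ j.succ p =
      -(ε * Real.exp (2 * (q (p 0) - γ * V (Fin.tail p)) - 2 * (P (p 0) + α * V (Fin.tail p)))
        * deriv q (p 0) * h (Fin.tail p) i j) := by
  rw [H.christoffel_zero α γ hp, pd_metric_succ_zero, pd_metric_succ_zero,
    H.pd_zero_metric_succ_succ α γ hp, sub_eq_add_neg (2 * _), Real.exp_add]
  ring

theorem christoffel_succ_zero_zero (H : IsWarpedData ε Ω J V h P q)
    (hp : p ∈ slab J Ω) (k : Fin n) :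
    christoffel (warpedMetric ε α γ V h P q) k.succ 0 0 p =
      -(ε * α * Real.exp (2 * (P (p 0) + α * V (Fin.tail p)) - 2 * (q (p 0) - γ * V (Fin.tail p)))
        * grad h V k (Fin.tail p)) := by
  rw [H.christoffel_succ α γ hp, grad, Finset.mul_sum, Finset.mul_sum, ← Finset.sum_neg_distrib]
  refine Finset.sum_congr rfl fun l _ => ?_
  rw [pd_metric_zero_succ, H.pd_succ_metric_zero_zero α γ hp, sub_eq_add_neg (2 * _), Real.exp_add]
  ring

/-- The spatial block depends on `y` only through the factor `e^{2q}`, so half its logarithmic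
`y`-derivative is `q'` times the identity. -/
theorem christoffel_succ_zero_succ (H : IsWarpedData ε Ω J V h P q)
    (hp : p ∈ slab J Ω) (k j : Fin n) :
    christoffel (warpedMetric ε α γ V h P q) k.succ 0 j.succ p =
      if k = j then deriv q (p 0) else 0 := by
  have h1 := H.metric.sum_inv_mul hp.2 k j
  have : (if k = j then deriv q (p 0) else 0) = deriv q (p 0) * if k = j then 1 else 0 := by simp
  rw [this, ← h1, H.christoffel_succ α γ hp, Finset.mul_sum, Finset.mul_sum]
  refine Finset.sum_congr rfl fun l _ => ?_
  rw [pd_metric_zero_succ, pd_metric_zero_succ, H.pd_zero_metric_succ_succ α γ hp, Real.exp_neg,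
    H.metric.symm _ hp.2 j l]
  have := Real.exp_ne_zero (2 * (q (p 0) - γ * V (Fin.tail p)))
  field_simp
  ring

/-- The conformal change formula for `e^{-2γV} h`; the factor `e^{2q}` is constant in `x` and drops
out. -/
theorem christoffel_succ_succ_succ (H : IsWarpedData ε Ω J V h P q)
    (hp : p ∈ slab J Ω) (k i j : Fin n) :
    christoffel (warpedMetric ε α γ V h P q) k.succ i.succ j.succ p =
      christoffel h k i j (Fin.tail p) - γ * ((if k = i then pd j V (Fin.tail p) else 0)
        + (if k = j then pd i V (Fin.tail p) else 0)
        - h (Fin.tail p) i j * grad h V k (Fin.tail p)) := by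
  -- Kronecker deltas are written as `h⁻¹ h`, so that both sides become sums over `l` comparable
  -- term by term.
  have h1 : ∀ a b : Fin n, (if k = a then pd b V (Fin.tail p) else 0)
      = ∑ l, (h (Fin.tail p))⁻¹ k l * h (Fin.tail p) l a * pd b V (Fin.tail p) := by
    intro a b
    rw [← Finset.sum_mul, H.metric.sum_inv_mul hp.2]; simp
  rw [h1, h1, H.christoffel_succ α γ hp, christoffel, grad]
  simp only [Finset.mul_sum, ← Finset.sum_add_distrib, ← Finset.sum_sub_distrib]
  refine Finset.sum_congr rfl fun l _ => ?_
  rw [H.pd_succ_metric_succ_succ α γ hp, H.pd_succ_metric_succ_succ α γ hp,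
    H.pd_succ_metric_succ_succ α γ hp, Real.exp_neg, H.metric.symm _ hp.2 j l,
    H.metric.symm _ hp.2 i l]
  have := Real.exp_ne_zero (2 * (q (p 0) - γ * V (Fin.tail p)))
  field_simp
  ring

theorem christoffel_zero_succ_zero (H : IsWarpedData ε Ω J V h P q)
    (hp : p ∈ slab J Ω) (i : Fin n) :
    christoffel (warpedMetric ε α γ V h P q) 0 i.succ 0 p = α * pd i V (Fin.tail p) := by
  rw [christoffel_symm (H.isMetricOn α γ) H.isOpen_slab hp, H.christoffel_zero_zero_succ α γ hp]

theorem christoffel_succ_succ_zero (H : IsWarpedData ε Ω J V h P q)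
    (hp : p ∈ slab J Ω) (k j : Fin n) :
    christoffel (warpedMetric ε α γ V h P q) k.succ j.succ 0 p =
      if k = j then deriv q (p 0) else 0 := by
  rw [christoffel_symm (H.isMetricOn α γ) H.isOpen_slab hp, H.christoffel_succ_zero_succ α γ hp]

end IsWarpedData

/-! ### Contractions of conformally changed connection coefficients. -/

section ConformalAlgebra

variable {n : ℕ}

/-- Contraction of conformally changed connection coefficients with a covector. -/
theorem sum_conformal_mul (Γ : Fin n → Fin n → Fin n → ℝ) (V v : Fin n → ℝ)
    (h : Matrix (Fin n) (Fin n) ℝ) (γ : ℝ) (X : Fin n → ℝ) (i j : Fin n) :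
    ∑ k, (Γ k i j - γ * ((if k = i then V j else 0) + (if k = j then V i else 0) - h i j * v k))
        * X k =
      ∑ k, Γ k i j * X k - γ * (X i * V j + X j * V i - h i j * ∑ k, v k * X k) := by
  have h1 : ∀ k, (Γ k i j - γ * ((if k = i then V j else 0) + (if k = j then V i else 0)
      - h i j * v k)) * X k = Γ k i j * X k - γ * ((if k = i then X k * V j else 0)
      + (if k = j then X k * V i else 0) - h i j * (v k * X k)) := by
    intro k; split_ifs <;> ring
  simp only [h1, Finset.sum_sub_distrib, ← Finset.mul_sum, Finset.sum_add_distrib]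
  simp

/-- The trace of conformally changed connection coefficients. -/
theorem sum_conformal_trace (Γ : Fin n → Fin n → Fin n → ℝ) (V v : Fin n → ℝ)
    (h : Matrix (Fin n) (Fin n) ℝ) (γ : ℝ) (hh : ∀ i j, h i j = h j i)
    (hv : ∀ i, ∑ k, h i k * v k = V i) (l : Fin n) :
    ∑ k, (Γ k k l - γ * (V l + (if k = l then V k else 0) - h k l * v k)) =
      ∑ k, Γ k k l - (n : ℝ) * γ * V l := by
  have hvl : ∑ k, h k l * v k = V l := by rw [← hv l]; simp only [hh l]
  simp only [Finset.sum_sub_distrib, ← Finset.mul_sum, Finset.sum_add_distrib, hvl]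
  simp
  ring

/-- The quadratic part of the Ricci tensor of conformally changed connection coefficients. -/
theorem sum_conformal_quadratic (Γ : Fin n → Fin n → Fin n → ℝ) (V v : Fin n → ℝ)
    (h : Matrix (Fin n) (Fin n) ℝ) (γ : ℝ) (C : Fin n → Fin n → Fin n → ℝ)
    (hC : ∀ k i j, C k i j = Γ k i j - γ * ((if k = i then V j else 0)
      + (if k = j then V i else 0) - h i j * v k))
    (hΓ : ∀ k i j, Γ k i j = Γ k j i) (hh : ∀ i j, h i j = h j i)
    (hv : ∀ i, ∑ k, h i k * v k = V i) (i j : Fin n) :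
    ∑ k, ∑ l, (C k k l * C l i j - C k j l * C l i k) =
      ∑ k, ∑ l, (Γ k k l * Γ l i j - Γ k j l * Γ l i k)
        + γ * h i j * (∑ k, ∑ l, Γ k k l * v l) - γ * ((n : ℝ) - 2) * ∑ l, Γ l i j * V l
        - γ * ∑ l, (∑ k, h i k * Γ k j l + ∑ k, h j k * Γ k i l) * v l
        + γ ^ 2 * ((n : ℝ) - 2) * (V i * V j - h i j * ∑ k, V k * v k) := by
  -- Products of two copies of `C` are expanded one factor at a time by this rule, with the other
  -- factor in the role of `X`.
  have contr : ∀ (X : Fin n → ℝ) (i j : Fin n), ∑ k, C k i j * X k = ∑ k, Γ k i j * X k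
      - γ * (X i * V j + X j * V i - h i j * ∑ k, v k * X k) := by
    intro X i j
    simp only [hC]
    exact sum_conformal_mul Γ V v h γ X i j
  have hCs : ∀ k i j, C k i j = C k j i := by
    intro k i j; rw [hC, hC, hΓ k i j, hh i j]; ring
  have trace : ∀ l, ∑ k, C k k l = ∑ k, Γ k k l - (n : ℝ) * γ * V l := by
    simp only [hC, if_true]
    exact sum_conformal_trace Γ V v h γ hh hv
  have hQ : ∑ k, v k * V k = ∑ k, V k * v k := by simp only [mul_comm]
  have e1 : ∑ k, ∑ l, C k k l * C l i j = ∑ l, (∑ k, Γ k k l) * Γ l i j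
      - (n : ℝ) * γ * ∑ l, Γ l i j * V l
      - γ * ((∑ k, Γ k k i) * V j + (∑ k, Γ k k j) * V i - 2 * (n : ℝ) * γ * V i * V j
        - h i j * ((∑ k, ∑ l, Γ k k l * v l) - (n : ℝ) * γ * ∑ k, V k * v k)) := by
    rw [Finset.sum_comm]
    simp only [← Finset.sum_mul, trace]
    rw [Finset.sum_congr rfl fun l _ => mul_comm _ (C l i j), contr]
    have a1 : ∑ k, Γ k i j * (∑ m, Γ m m k - (n : ℝ) * γ * V k)
        = ∑ l, (∑ k, Γ k k l) * Γ l i j - (n : ℝ) * γ * ∑ l, Γ l i j * V l := by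
      rw [Finset.mul_sum, ← Finset.sum_sub_distrib]
      exact Finset.sum_congr rfl fun k _ => by ring
    have a2 : ∑ k, v k * (∑ m, Γ m m k - (n : ℝ) * γ * V k)
        = (∑ k, ∑ l, Γ k k l * v l) - (n : ℝ) * γ * ∑ k, V k * v k := by
      rw [Finset.sum_comm, Finset.mul_sum, ← Finset.sum_sub_distrib]
      refine Finset.sum_congr rfl fun k _ => ?_
      rw [← Finset.sum_mul]; ring
    rw [a1, a2]
    ring
  have b1 : ∑ k, ∑ l, Γ l i k * C k j l = ∑ k, ∑ l, Γ k j l * Γ l i k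
      - γ * (∑ l, Γ l i j * V l + (∑ k, Γ k k i) * V j
        - ∑ l, (∑ k, h j k * Γ k i l) * v l) := by
    rw [Finset.sum_comm]
    have : ∀ l, ∑ k, Γ l i k * C k j l = ∑ k, Γ k j l * Γ l i k
        - γ * (Γ l i j * V l + Γ l i l * V j - h j l * ∑ k, v k * Γ l i k) := by
      intro l
      rw [Finset.sum_congr rfl fun k _ => mul_comm _ (C k j l), contr]
    have hswap : ∑ l, h j l * ∑ k, v k * Γ l i k = ∑ l, (∑ k, h j k * Γ k i l) * v l := by
      simp only [Finset.mul_sum, Finset.sum_mul]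
      rw [Finset.sum_comm]
      exact Finset.sum_congr rfl fun k _ => Finset.sum_congr rfl fun l _ => by ring
    have htrace : ∑ l, Γ l i l = ∑ l, Γ l l i := Finset.sum_congr rfl fun l _ => hΓ l i l
    simp only [this, Finset.sum_sub_distrib, ← Finset.mul_sum, Finset.sum_add_distrib,
      ← Finset.sum_mul, hswap, htrace]
    rw [Finset.sum_comm]
  -- Contracting with `v` makes the two terms in `V i * V j` cancel, so that only the multiple of `h
  -- i j` survives.
  have b4 : ∑ k, h i k * ∑ l, v l * C k j l = ∑ l, (∑ k, h i k * Γ k j l) * v l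
      - γ * h i j * ∑ k, V k * v k := by
    have : ∀ l, ∑ k, h i k * C k j l = ∑ k, h i k * Γ k j l
        - γ * (h i j * V l + h i l * V j - h j l * V i) := by
      intro l
      rw [Finset.sum_congr rfl fun k _ => mul_comm _ (C k j l), contr]
      simp only [mul_comm (v _), hv]
      simp only [mul_comm (h i _)]
    calc ∑ k, h i k * ∑ l, v l * C k j l = ∑ l, (∑ k, h i k * C k j l) * v l := by
          simp only [Finset.mul_sum, Finset.sum_mul]
          rw [Finset.sum_comm]
          exact Finset.sum_congr rfl fun k _ => Finset.sum_congr rfl fun l _ => by ring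
      _ = ∑ l, ((∑ k, h i k * Γ k j l) * v l - γ * h i j * (V l * v l)
            - γ * V j * (h i l * v l) + γ * V i * (h j l * v l)) :=
          Finset.sum_congr rfl fun l _ => by rw [this]; ring
      _ = _ := by
          simp only [Finset.sum_add_distrib, Finset.sum_sub_distrib, ← Finset.mul_sum, hv]
          ring
  have e2 : ∑ k, ∑ l, C k j l * C l i k = ∑ k, ∑ l, Γ k j l * Γ l i k
      - γ * (∑ l, Γ l i j * V l + (∑ k, Γ k k i) * V j
        - ∑ l, (∑ k, h j k * Γ k i l) * v l)
      - γ * (∑ l, Γ l i j * V l - γ * (2 * V i * V j - h i j * ∑ k, V k * v k)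
        + (∑ k, Γ k k j - (n : ℝ) * γ * V j) * V i
        - (∑ l, (∑ k, h i k * Γ k j l) * v l - γ * h i j * ∑ k, V k * v k)) := by
    have : ∀ k, ∑ l, C k j l * C l i k = ∑ l, Γ l i k * C k j l
        - γ * (C k j i * V k + C k k j * V i - h i k * ∑ l, v l * C k j l) := by
      intro k
      rw [Finset.sum_congr rfl fun l _ => mul_comm _ (C l i k), contr, hCs k k j]
    simp only [this, Finset.sum_sub_distrib, ← Finset.mul_sum, Finset.sum_add_distrib,
      ← Finset.sum_mul, b1, b4, trace, contr, hQ]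
    simp only [hΓ _ j i, hh j i]
    ring
  simp only [Finset.sum_sub_distrib]
  have e3 : ∑ l, (∑ k, Γ k k l) * Γ l i j = ∑ k, ∑ l, Γ k k l * Γ l i j := by
    rw [Finset.sum_comm]; simp only [Finset.sum_mul]
  rw [e1, e2, e3]
  simp only [add_mul, Finset.sum_add_distrib]
  ring

end ConformalAlgebra

/-! ### The Ricci tensor and the wave operator of a warped metric. -/

/-- The Hessian of a function with respect to the Levi-Civita connection. -/
def hess {ι : Type} [Fintype ι] [DecidableEq ι] (g : (ι → ℝ) → Matrix ι ι ℝ) (f : (ι → ℝ) → ℝ)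
    (i j : ι) (p : ι → ℝ) : ℝ :=
  pd i (pd j f) p - ∑ k, christoffel g k i j p * pd k f p

namespace IsWarpedData

variable {n : ℕ} {ε : ℝ} {Ω : Set (Fin n → ℝ)} {J : Set ℝ} {V : (Fin n → ℝ) → ℝ}
  {h : (Fin n → ℝ) → Matrix (Fin n) (Fin n) ℝ} {P q : ℝ → ℝ}
  (α γ : ℝ) {p : Fin (n + 1) → ℝ}

theorem pd_congr_slab (H : IsWarpedData ε Ω J V h P q) (hp : p ∈ slab J Ω) {m : Fin (n + 1)}
    {f g : (Fin (n + 1) → ℝ) → ℝ} {c : ℝ} (hg : HasPd m g c p) (hfg : ∀ r ∈ slab J Ω, f r = g r) :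
    pd m f p = c :=
  (hg.congr H.isOpen_slab hp hfg).2

theorem pd_succ_christoffel_succ_zero_zero (H : IsWarpedData ε Ω J V h P q)
    (hp : p ∈ slab J Ω) (m k : Fin n) :
    pd m.succ (christoffel (warpedMetric ε α γ V h P q) k.succ 0 0) p =
      -(ε * α * Real.exp (2 * (P (p 0) + α * V (Fin.tail p)) - 2 * (q (p 0) - γ * V (Fin.tail p)))
        * (2 * (α + γ) * pd m V (Fin.tail p) * grad h V k (Fin.tail p)
          + pd m (grad h V k) (Fin.tail p))) := by
  have hV := H.hasPd_succ_tail hp H.smoothV m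
  have hd := (((((((H.hasPd_succ_P hp m).add (hV.const_mul α)).const_mul 2).sub
      (((H.hasPd_succ_q hp m).sub (hV.const_mul γ)).const_mul 2)).exp.const_mul (ε * α))).mul
      (H.hasPd_succ_tail hp (contDiffOn_grad H.openΩ H.metric H.smoothV k) m)).neg
  refine (H.pd_congr_slab hp hd fun r hr => H.christoffel_succ_zero_zero α γ hr k).trans ?_
  ring

theorem pd_zero_christoffel_succ_zero_succ (H : IsWarpedData ε Ω J V h P q)
    (hp : p ∈ slab J Ω) (k j : Fin n) :
    pd 0 (christoffel (warpedMetric ε α γ V h P q) k.succ 0 j.succ) p =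
      if k = j then deriv (deriv q) (p 0) else 0 := by
  refine H.pd_congr_slab hp ?_ fun r hr => H.christoffel_succ_zero_succ α γ hr k j
  split_ifs
  · exact H.hasPd_zero_dq hp
  · exact HasPd.const 0

theorem pd_succ_christoffel_succ_zero_succ (H : IsWarpedData ε Ω J V h P q)
    (hp : p ∈ slab J Ω) (m k j : Fin n) :
    pd m.succ (christoffel (warpedMetric ε α γ V h P q) k.succ 0 j.succ) p = 0 := by
  refine H.pd_congr_slab hp ?_ fun r hr => H.christoffel_succ_zero_succ α γ hr k j
  split_ifs
  · exact H.hasPd_succ_dq hp m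
  · exact HasPd.const 0

theorem pd_succ_christoffel_succ_succ_zero (H : IsWarpedData ε Ω J V h P q)
    (hp : p ∈ slab J Ω) (m k j : Fin n) :
    pd m.succ (christoffel (warpedMetric ε α γ V h P q) k.succ j.succ 0) p = 0 := by
  refine H.pd_congr_slab hp ?_ fun r hr => H.christoffel_succ_succ_zero α γ hr k j
  split_ifs
  · exact H.hasPd_succ_dq hp m
  · exact HasPd.const 0

theorem pd_zero_christoffel_zero_zero_succ (H : IsWarpedData ε Ω J V h P q)
    (hp : p ∈ slab J Ω) (j : Fin n) :
    pd 0 (christoffel (warpedMetric ε α γ V h P q) 0 0 j.succ) p = 0 := by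
  refine H.pd_congr_slab hp ?_ fun r hr => H.christoffel_zero_zero_succ α γ hr j
  simpa using (H.hasPd_zero_tail hp (contDiffOn_pd H.openΩ H.smoothV j)).const_mul α

theorem pd_succ_christoffel_zero_succ_zero (H : IsWarpedData ε Ω J V h P q)
    (hp : p ∈ slab J Ω) (m j : Fin n) :
    pd m.succ (christoffel (warpedMetric ε α γ V h P q) 0 j.succ 0) p =
      α * pd m (pd j V) (Fin.tail p) :=
  H.pd_congr_slab hp
    ((H.hasPd_succ_tail hp (contDiffOn_pd H.openΩ H.smoothV j) m).const_mul α)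
    fun _ hr => H.christoffel_zero_succ_zero α γ hr j

theorem pd_succ_christoffel_zero_zero_zero (H : IsWarpedData ε Ω J V h P q)
    (hp : p ∈ slab J Ω) (m : Fin n) :
    pd m.succ (christoffel (warpedMetric ε α γ V h P q) 0 0 0) p = 0 :=
  H.pd_congr_slab hp (H.hasPd_succ_dP hp m) fun _ hr => H.christoffel_zero_zero_zero α γ hr

theorem pd_zero_christoffel_zero_succ_succ (H : IsWarpedData ε Ω J V h P q)
    (hp : p ∈ slab J Ω) (i j : Fin n) :
    pd 0 (christoffel (warpedMetric ε α γ V h P q) 0 i.succ j.succ) p =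
      -(ε * Real.exp (2 * (q (p 0) - γ * V (Fin.tail p)) - 2 * (P (p 0) + α * V (Fin.tail p)))
        * (2 * (deriv q (p 0) - deriv P (p 0)) * deriv q (p 0) + deriv (deriv q) (p 0))
        * h (Fin.tail p) i j) := by
  have hV := H.hasPd_zero_tail hp H.smoothV
  have hd := (((((((H.hasPd_zero_q hp).sub (hV.const_mul γ)).const_mul 2).sub
      (((H.hasPd_zero_P hp).add (hV.const_mul α)).const_mul 2)).exp.const_mul ε).mul
      (H.hasPd_zero_dq hp)).mul (H.hasPd_zero_tail hp (H.metric.smooth i j))).neg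
  refine (H.pd_congr_slab hp hd fun r hr => H.christoffel_zero_succ_succ α γ hr i j).trans ?_
  ring

theorem pd_zero_christoffel_succ_succ_succ (H : IsWarpedData ε Ω J V h P q)
    (hp : p ∈ slab J Ω) (k i j : Fin n) :
    pd 0 (christoffel (warpedMetric ε α γ V h P q) k.succ i.succ j.succ) p = 0 := by
  have hd : ∀ i, ContDiffOn ℝ ∞ (pd i V) Ω := contDiffOn_pd H.openΩ H.smoothV
  have hite : ∀ a b : Fin n, ContDiffOn ℝ ∞ (fun x => if k = a then pd b V x else 0) Ω := by
    intro a b; split_ifs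
    · exact hd b
    · exact contDiffOn_const
  refine H.pd_congr_slab hp (H.hasPd_zero_tail (f := fun x => christoffel h k i j x
    - γ * ((if k = i then pd j V x else 0) + (if k = j then pd i V x else 0)
      - h x i j * grad h V k x)) hp ?_) fun r hr => H.christoffel_succ_succ_succ α γ hr k i j
  exact (contDiffOn_christoffel H.openΩ H.metric k i j).sub (contDiffOn_const.mul
    (((hite i j).add (hite j i)).sub ((H.metric.smooth i j).mul
      (contDiffOn_grad H.openΩ H.metric H.smoothV k))))

theorem pd_succ_christoffel_succ_succ_succ (H : IsWarpedData ε Ω J V h P q)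
    (hp : p ∈ slab J Ω) (m k i j : Fin n) :
    pd m.succ (christoffel (warpedMetric ε α γ V h P q) k.succ i.succ j.succ) p =
      pd m (christoffel h k i j) (Fin.tail p) - γ *
        ((if k = i then pd m (pd j V) (Fin.tail p) else 0)
          + (if k = j then pd m (pd i V) (Fin.tail p) else 0)
          - (pd m (fun x => h x i j) (Fin.tail p) * grad h V k (Fin.tail p)
            + h (Fin.tail p) i j * pd m (grad h V k) (Fin.tail p))) := by
  have hd : ∀ i, ContDiffOn ℝ ∞ (pd i V) Ω := contDiffOn_pd H.openΩ H.smoothV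
  have hite : ∀ a b : Fin n, HasPd m.succ
      (fun r : Fin (n + 1) → ℝ => if k = a then pd b V (Fin.tail r) else 0)
      (if k = a then pd m (pd b V) (Fin.tail p) else 0) p := by
    intro a b; split_ifs
    · exact H.hasPd_succ_tail hp (hd b) m
    · exact HasPd.const 0
  refine H.pd_congr_slab hp ?_ fun r hr => H.christoffel_succ_succ_succ α γ hr k i j
  exact (H.hasPd_succ_tail hp (contDiffOn_christoffel H.openΩ H.metric k i j) m).sub
    ((((hite i j).add (hite j i)).sub ((H.hasPd_succ_tail hp (H.metric.smooth i j) m).mul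
      (H.hasPd_succ_tail hp (contDiffOn_grad H.openΩ H.metric H.smoothV k) m))).const_mul γ)

theorem sum_christoffel_succ_trace (H : IsWarpedData ε Ω J V h P q) (hp : p ∈ slab J Ω)
    (l : Fin n) : ∑ k : Fin n, christoffel (warpedMetric ε α γ V h P q) k.succ k.succ l.succ p =
      ∑ k, christoffel h k k l (Fin.tail p) - (n : ℝ) * γ * pd l V (Fin.tail p) := by
  simp only [H.christoffel_succ_succ_succ α γ hp, if_true]
  exact sum_conformal_trace (fun k i j => christoffel h k i j (Fin.tail p)) _ _ _ γ
    (H.metric.symm _ hp.2) (fun i => sum_metric_mul_grad H.metric V hp.2 i) l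

theorem sum_christoffel_succ_trace_right (H : IsWarpedData ε Ω J V h P q) (hp : p ∈ slab J Ω)
    (l : Fin n) : ∑ k : Fin n, christoffel (warpedMetric ε α γ V h P q) k.succ l.succ k.succ p =
      ∑ k, christoffel h k k l (Fin.tail p) - (n : ℝ) * γ * pd l V (Fin.tail p) := by
  rw [← H.sum_christoffel_succ_trace α γ hp]
  exact Finset.sum_congr rfl fun k _ =>
    christoffel_symm (H.isMetricOn α γ) H.isOpen_slab hp _ _ _

theorem sum_christoffel_succ_mul (H : IsWarpedData ε Ω J V h P q) (hp : p ∈ slab J Ω)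
    (i j : Fin n) : ∑ l : Fin n, christoffel (warpedMetric ε α γ V h P q) l.succ i.succ j.succ p
        * pd l V (Fin.tail p) =
      ∑ l, christoffel h l i j (Fin.tail p) * pd l V (Fin.tail p)
        - γ * (2 * pd i V (Fin.tail p) * pd j V (Fin.tail p)
          - h (Fin.tail p) i j * gradSq h V (Fin.tail p)) := by
  simp only [H.christoffel_succ_succ_succ α γ hp]
  refine (sum_conformal_mul (fun k i j => christoffel h k i j (Fin.tail p))
    (fun i => pd i V (Fin.tail p)) _ _ γ _ i j).trans ?_
  simp only [gradSq, mul_comm (grad h V _ _)]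
  ring

/-- The terms in `V` gather through `sum_pd_grad` into the expression that reappears in
`box_warpedMetric`; for a seed and `γ` = `gammaOf` it vanishes. -/
theorem ricci_zero_zero (H : IsWarpedData ε Ω J V h P q) (hp : p ∈ slab J Ω) :
    ricci (warpedMetric ε α γ V h P q) 0 0 p =
      -(n : ℝ) * (deriv (deriv q) (p 0) + deriv q (p 0) ^ 2 - deriv q (p 0) * deriv P (p 0))
      - ε * Real.exp (2 * (P (p 0) + α * V (Fin.tail p)) - 2 * (q (p 0) - γ * V (Fin.tail p)))
        * α * (box h V (Fin.tail p) + (α - ((n : ℝ) - 2) * γ) * gradSq h V (Fin.tail p)) := by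
  have htr := sum_pd_grad H.openΩ H.metric H.smoothV hp.2
  have htrace := H.sum_christoffel_succ_trace α γ hp
  simp only [ricci, Fin.sum_univ_succ, H.pd_succ_christoffel_succ_zero_zero α γ hp,
    H.pd_zero_christoffel_succ_zero_succ α γ hp, H.christoffel_zero_zero_zero α γ hp,
    H.christoffel_zero_zero_succ α γ hp, H.christoffel_succ_zero_zero α γ hp,
    H.christoffel_succ_zero_succ α γ hp, H.christoffel_succ_succ_zero α γ hp]
  generalize hC : christoffel (warpedMetric ε α γ V h P q) = C at htrace ⊢
  generalize Real.exp (2 * (P (p 0) + α * V (Fin.tail p))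
    - 2 * (q (p 0) - γ * V (Fin.tail p))) = E
  have h1 : ∑ k : Fin n, ∑ l : Fin n, C k.succ k.succ l.succ p
        * (ε * α * E * grad h V l (Fin.tail p)) =
      ε * α * E * ((∑ k, ∑ l, christoffel h k k l (Fin.tail p) * grad h V l (Fin.tail p))
        - n * γ * gradSq h V (Fin.tail p)) := by
    rw [Finset.sum_comm, gradSq, Finset.sum_comm (f := fun k l => christoffel h k k l (Fin.tail p)
      * grad h V l (Fin.tail p))]
    simp only [← Finset.sum_mul, htrace]
    rw [Finset.mul_sum, ← Finset.sum_sub_distrib, Finset.mul_sum]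
    exact Finset.sum_congr rfl fun l _ => by ring
  have h2 : ∑ k : Fin n, ε * α * E * (2 * (α + γ) * pd k V (Fin.tail p) * grad h V k (Fin.tail p)
      + pd k (grad h V k) (Fin.tail p)) = ε * α * E * (2 * (α + γ) * gradSq h V (Fin.tail p)
        + ∑ k, pd k (grad h V k) (Fin.tail p)) := by
    rw [gradSq, Finset.mul_sum, ← Finset.sum_add_distrib, Finset.mul_sum]
    exact Finset.sum_congr rfl fun l _ => by ring
  have h3 : ∑ k : Fin n, ε * α * E * grad h V k (Fin.tail p) * (α * pd k V (Fin.tail p))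
      = ε * α * E * α * gradSq h V (Fin.tail p) := by
    rw [gradSq, Finset.mul_sum]
    exact Finset.sum_congr rfl fun l _ => by ring
  simp [Finset.sum_add_distrib, Finset.sum_sub_distrib, h1, h2, h3]
  rw [← htr]
  ring

/-- The exponentials in `Γ^k_{00}` and `Γ^0_{ij}` are reciprocal, so none is left in the mixed Ricci
components. -/
theorem exp_sub_mul_exp_sub (a b : ℝ) : Real.exp (a - b) * Real.exp (b - a) = 1 := by
  rw [← Real.exp_add]; simp

theorem ricci_zero_succ (H : IsWarpedData ε Ω J V h P q) (hp : p ∈ slab J Ω) (j : Fin n) :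
    ricci (warpedMetric ε α γ V h P q) 0 j.succ p =
      ((n : ℝ) - 1) * deriv q (p 0) * (α * pd j V (Fin.tail p)) := by
  have htrace := H.sum_christoffel_succ_trace α γ hp j
  have htrace' := H.sum_christoffel_succ_trace_right α γ hp j
  have hv := sum_metric_mul_grad H.metric V hp.2 j
  have hE := exp_sub_mul_exp_sub (2 * (P (p 0) + α * V (Fin.tail p)))
    (2 * (q (p 0) - γ * V (Fin.tail p)))
  simp only [ricci, Fin.sum_univ_succ, H.pd_zero_christoffel_zero_zero_succ α γ hp,
    H.pd_succ_christoffel_zero_zero_zero α γ hp, H.pd_succ_christoffel_succ_zero_succ α γ hp,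
    H.christoffel_zero_zero_zero α γ hp,
    H.christoffel_zero_zero_succ α γ hp, H.christoffel_succ_zero_zero α γ hp,
    H.christoffel_succ_zero_succ α γ hp, H.christoffel_succ_succ_zero α γ hp,
    H.christoffel_zero_succ_zero α γ hp, H.christoffel_zero_succ_succ α γ hp]
  generalize christoffel (warpedMetric ε α γ V h P q) = C at htrace htrace' ⊢
  generalize Real.exp (2 * (P (p 0) + α * V (Fin.tail p))
    - 2 * (q (p 0) - γ * V (Fin.tail p))) = E at hE ⊢
  generalize Real.exp (2 * (q (p 0) - γ * V (Fin.tail p))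
    - 2 * (P (p 0) + α * V (Fin.tail p))) = F at hE ⊢
  have h1 : ∑ k : Fin n, ε * F * deriv q (p 0) * h (Fin.tail p) j k
      * (ε * α * E * grad h V k (Fin.tail p)) = deriv q (p 0) * α * pd j V (Fin.tail p) := by
    rw [← hv, Finset.mul_sum]
    refine Finset.sum_congr rfl fun l _ => ?_
    linear_combination (deriv q (p 0) * h (Fin.tail p) j l * α * grad h V l (Fin.tail p)) *
      (E * F * H.sign + hE)
  simp [Finset.sum_add_distrib, Finset.sum_sub_distrib, ← Finset.sum_mul, h1,
    htrace, htrace']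
  ring

/-- The defining formula of `ricci` is not manifestly symmetric, so this component is computed
separately from `ricci_zero_succ`. -/
theorem ricci_succ_zero (H : IsWarpedData ε Ω J V h P q) (hp : p ∈ slab J Ω) (j : Fin n) :
    ricci (warpedMetric ε α γ V h P q) j.succ 0 p =
      ((n : ℝ) - 1) * deriv q (p 0) * (α * pd j V (Fin.tail p)) := by
  have htrace := H.sum_christoffel_succ_trace α γ hp j
  have htrace' := H.sum_christoffel_succ_trace_right α γ hp j
  have hv := sum_metric_mul_grad H.metric V hp.2 j
  have hE := exp_sub_mul_exp_sub (2 * (P (p 0) + α * V (Fin.tail p)))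
    (2 * (q (p 0) - γ * V (Fin.tail p)))
  simp only [ricci, Fin.sum_univ_succ,
    H.pd_succ_christoffel_succ_succ_zero α γ hp, H.pd_zero_christoffel_succ_succ_succ α γ hp,
    H.christoffel_zero_zero_zero α γ hp,
    H.christoffel_zero_zero_succ α γ hp, H.christoffel_succ_zero_zero α γ hp,
    H.christoffel_succ_zero_succ α γ hp, H.christoffel_succ_succ_zero α γ hp,
    H.christoffel_zero_succ_zero α γ hp, H.christoffel_zero_succ_succ α γ hp]
  generalize christoffel (warpedMetric ε α γ V h P q) = C at htrace htrace' ⊢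
  generalize Real.exp (2 * (P (p 0) + α * V (Fin.tail p))
    - 2 * (q (p 0) - γ * V (Fin.tail p))) = E at hE ⊢
  generalize Real.exp (2 * (q (p 0) - γ * V (Fin.tail p))
    - 2 * (P (p 0) + α * V (Fin.tail p))) = F at hE ⊢
  have h1 : ∑ k : Fin n, ε * α * E * grad h V k (Fin.tail p)
      * (ε * F * deriv q (p 0) * h (Fin.tail p) j k) = deriv q (p 0) * α * pd j V (Fin.tail p) := by
    rw [← hv, Finset.mul_sum]
    refine Finset.sum_congr rfl fun l _ => ?_
    linear_combination (deriv q (p 0) * h (Fin.tail p) j l * α * grad h V l (Fin.tail p)) *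
      (E * F * H.sign + hE)
  simp [Finset.sum_add_distrib, Finset.sum_sub_distrib, ← Finset.sum_mul, ← Finset.mul_sum, h1,
    htrace, htrace']
  ring

theorem ricci_succ_succ (H : IsWarpedData ε Ω J V h P q) (hp : p ∈ slab J Ω) (i j : Fin n) :
    ricci (warpedMetric ε α γ V h P q) i.succ j.succ p =
      ricci h i j (Fin.tail p) + (γ * ((n : ℝ) - 2) - α) * hess h V i j (Fin.tail p)
      + (γ ^ 2 * ((n : ℝ) - 2) - α ^ 2 - 2 * α * γ)
        * (pd i V (Fin.tail p) * pd j V (Fin.tail p))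
      + h (Fin.tail p) i j * (γ * box h V (Fin.tail p)
        - γ * (((n : ℝ) - 2) * γ - α) * gradSq h V (Fin.tail p))
      - ε * Real.exp (2 * (q (p 0) - γ * V (Fin.tail p)) - 2 * (P (p 0) + α * V (Fin.tail p)))
        * h (Fin.tail p) i j * (deriv (deriv q) (p 0) + (n : ℝ) * deriv q (p 0) ^ 2
          - deriv q (p 0) * deriv P (p 0)) := by
  have htr := sum_pd_grad H.openΩ H.metric H.smoothV hp.2
  have hquad := sum_conformal_quadratic (fun k i j => christoffel h k i j (Fin.tail p))
    (fun i => pd i V (Fin.tail p)) (fun i => grad h V i (Fin.tail p)) (h (Fin.tail p)) γ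
    (fun k i j => christoffel (warpedMetric ε α γ V h P q) k.succ i.succ j.succ p)
    (H.christoffel_succ_succ_succ α γ hp)
    (fun k i j => christoffel_symm H.metric H.openΩ hp.2 k i j)
    (H.metric.symm _ hp.2) (fun i => sum_metric_mul_grad H.metric V hp.2 i) i j
  have hcontr := H.sum_christoffel_succ_mul α γ hp i j
  have hsymm := H.metric.symm _ hp.2 j i
  -- Splitting off the index `0` leaves the Ricci expression of the conformally changed spatial
  -- connection, plus terms from the `y`-direction.
  have hsplit : ricci (warpedMetric ε α γ V h P q) i.succ j.succ p =
      (∑ k : Fin n, (pd k.succ (christoffel (warpedMetric ε α γ V h P q) k.succ i.succ j.succ) p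
        - pd j.succ (christoffel (warpedMetric ε α γ V h P q) k.succ i.succ k.succ) p))
      + (∑ k : Fin n, ∑ l : Fin n,
        (christoffel (warpedMetric ε α γ V h P q) k.succ k.succ l.succ p
          * christoffel (warpedMetric ε α γ V h P q) l.succ i.succ j.succ p
        - christoffel (warpedMetric ε α γ V h P q) k.succ j.succ l.succ p
          * christoffel (warpedMetric ε α γ V h P q) l.succ i.succ k.succ p))
      + (-(ε * Real.exp (2 * (q (p 0) - γ * V (Fin.tail p)) - 2 * (P (p 0) + α * V (Fin.tail p)))
        * (deriv (deriv q) (p 0) + (n : ℝ) * deriv q (p 0) ^ 2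
          - deriv q (p 0) * deriv P (p 0)) * h (Fin.tail p) i j)
        - α * pd j (pd i V) (Fin.tail p)
        - α ^ 2 * pd i V (Fin.tail p) * pd j V (Fin.tail p))
      + α * ∑ l : Fin n, christoffel (warpedMetric ε α γ V h P q) l.succ i.succ j.succ p
          * pd l V (Fin.tail p) := by
    rw [ricci]
    simp only [Fin.sum_univ_succ, H.pd_zero_christoffel_zero_succ_succ α γ hp,
      H.pd_succ_christoffel_zero_succ_zero α γ hp,
      H.christoffel_zero_zero_zero α γ hp,
      H.christoffel_zero_zero_succ α γ hp, H.christoffel_succ_succ_zero α γ hp,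
      H.christoffel_zero_succ_zero α γ hp, H.christoffel_zero_succ_succ α γ hp]
    generalize christoffel (warpedMetric ε α γ V h P q) = C
    have h1 : ∑ l : Fin n, α * pd l V (Fin.tail p) * C l.succ i.succ j.succ p
        = ∑ l : Fin n, α * (C l.succ i.succ j.succ p * pd l V (Fin.tail p)) :=
      Finset.sum_congr rfl fun l _ => by ring
    simp [Finset.sum_add_distrib, Finset.sum_sub_distrib, Finset.mul_sum, h1, hsymm]
    ring
  have hderiv : ∑ k : Fin n,
      (pd k.succ (christoffel (warpedMetric ε α γ V h P q) k.succ i.succ j.succ) p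
        - pd j.succ (christoffel (warpedMetric ε α γ V h P q) k.succ i.succ k.succ) p) =
      ∑ k, (pd k (christoffel h k i j) (Fin.tail p) - pd j (christoffel h k i k) (Fin.tail p))
      + γ * ((n : ℝ) - 2) * pd i (pd j V) (Fin.tail p)
      + γ * ∑ k, pd k (fun x => h x i j) (Fin.tail p) * grad h V k (Fin.tail p)
      + γ * h (Fin.tail p) i j * ∑ k, pd k (grad h V k) (Fin.tail p) := by
    -- The trace term contains `∂_j (h_{ik} ∇^k V)`, which is `∂_j ∂_i V`.
    have hVV := pd_pd_eq_sum H.openΩ H.metric H.smoothV hp.2 i j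
    have hcomm := pd_comm H.openΩ H.smoothV hp.2 j i
    simp only [H.pd_succ_christoffel_succ_succ_succ α γ hp, Finset.sum_sub_distrib,
      ← Finset.mul_sum, Finset.sum_add_distrib] at hVV ⊢
    simp
    linear_combination γ * hVV + γ * ((n : ℝ) - 1) * hcomm
  -- By metric compatibility, this part of `hquad` cancels the derivative of `h` in `hderiv`.
  have hdiv : ∑ l, (∑ k, h (Fin.tail p) i k * christoffel h k j l (Fin.tail p)
      + ∑ k, h (Fin.tail p) j k * christoffel h k i l (Fin.tail p)) * grad h V l (Fin.tail p)
      = ∑ k, pd k (fun x => h x i j) (Fin.tail p) * grad h V k (Fin.tail p) := by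
    refine Finset.sum_congr rfl fun l _ => ?_
    rw [pd_metric H.metric H.openΩ hp.2]
    simp only [christoffel_symm H.metric H.openΩ hp.2 _ l]
    ring
  rw [hsplit, hderiv, hquad, hdiv, hcontr, hess, ricci, ← htr, gradSq,
    pd_comm H.openΩ H.smoothV hp.2 j i]
  ring

theorem hasDerivAt_of_smooth (H : IsWarpedData ε Ω J V h P q) (hp : p ∈ slab J Ω) {τ : ℝ → ℝ}
    (hτ : ContDiffOn ℝ ∞ τ J) : HasDerivAt τ (deriv τ (p 0)) (p 0) :=
  ((hτ.contDiffAt (H.openJ.mem_nhds hp.1)).differentiableAt (by simp)).hasDerivAt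

theorem pd_zero_field (H : IsWarpedData ε Ω J V h P q) (hp : p ∈ slab J Ω) (σ : ℝ) {τ : ℝ → ℝ}
    (hτ : ContDiffOn ℝ ∞ τ J) :
    pd 0 (fun r : Fin (n + 1) → ℝ => σ * V (Fin.tail r) + τ (r 0)) p = deriv τ (p 0) := by
  refine (((H.hasPd_zero_tail hp H.smoothV).const_mul σ).add
    (HasPd.zero_comp_zero (H.hasDerivAt_of_smooth hp hτ))).2.trans ?_
  ring

theorem pd_succ_field (H : IsWarpedData ε Ω J V h P q) (hp : p ∈ slab J Ω) (σ : ℝ) {τ : ℝ → ℝ}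
    (hτ : ContDiffOn ℝ ∞ τ J) (j : Fin n) :
    pd j.succ (fun r : Fin (n + 1) → ℝ => σ * V (Fin.tail r) + τ (r 0)) p
      = σ * pd j V (Fin.tail p) := by
  refine (((H.hasPd_succ_tail hp H.smoothV j).const_mul σ).add
    (HasPd.succ_comp_zero j (H.hasDerivAt_of_smooth hp hτ).differentiableAt)).2.trans ?_
  ring

theorem box_warpedMetric (H : IsWarpedData ε Ω J V h P q) (hp : p ∈ slab J Ω) (σ : ℝ) {τ : ℝ → ℝ}
    (hτ : ContDiffOn ℝ ∞ τ J) :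
    box (warpedMetric ε α γ V h P q) (fun r => σ * V (Fin.tail r) + τ (r 0)) p =
      ε * Real.exp (-(2 * (P (p 0) + α * V (Fin.tail p)))) *
        (deriv (deriv τ) (p 0) - deriv P (p 0) * deriv τ (p 0)
          + (n : ℝ) * deriv q (p 0) * deriv τ (p 0))
      + σ * Real.exp (-(2 * (q (p 0) - γ * V (Fin.tail p)))) *
        (box h V (Fin.tail p) + (α - ((n : ℝ) - 2) * γ) * gradSq h V (Fin.tail p)) := by
  have hdτ : HasDerivAt (deriv τ) (deriv (deriv τ) (p 0)) (p 0) :=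
    (((hτ.deriv_of_isOpen (m := ∞) H.openJ (by simp)).contDiffAt
      (H.openJ.mem_nhds hp.1)).differentiableAt (by simp)).hasDerivAt
  have h0 := fun r hr => H.pd_zero_field (p := r) hr σ hτ
  have h1 := fun r hr j => H.pd_succ_field (p := r) hr σ hτ j
  have h00 := H.pd_congr_slab hp (HasPd.zero_comp_zero hdτ) h0
  have h11 := fun i j : Fin n => H.pd_congr_slab hp
    ((H.hasPd_succ_tail hp (contDiffOn_pd H.openΩ H.smoothV j) i).const_mul σ)
    fun r hr => h1 r hr j
  have hE : Real.exp (-(2 * (P (p 0) + α * V (Fin.tail p)))) * Real.exp (2 * (P (p 0)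
      + α * V (Fin.tail p)) - 2 * (q (p 0) - γ * V (Fin.tail p)))
      = Real.exp (-(2 * (q (p 0) - γ * V (Fin.tail p)))) := by
    rw [← Real.exp_add]; ring_nf
  have hF : Real.exp (-(2 * (q (p 0) - γ * V (Fin.tail p)))) * Real.exp (2 * (q (p 0)
      - γ * V (Fin.tail p)) - 2 * (P (p 0) + α * V (Fin.tail p)))
      = Real.exp (-(2 * (P (p 0) + α * V (Fin.tail p)))) := by
    rw [← Real.exp_add]; ring_nf
  have htrace : ∑ i, ∑ j, (h (Fin.tail p))⁻¹ i j * h (Fin.tail p) i j = n := by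
    have : ∀ i, ∑ j, (h (Fin.tail p))⁻¹ i j * h (Fin.tail p) i j = 1 := by
      intro i
      rw [Finset.sum_congr rfl fun j _ => by rw [H.metric.symm _ hp.2 i j],
        H.metric.sum_inv_mul hp.2, if_pos rfl]
    simp [this]
  have hQ : ∑ i, ∑ j, (h (Fin.tail p))⁻¹ i j * (pd i V (Fin.tail p) * pd j V (Fin.tail p))
      = gradSq h V (Fin.tail p) := by
    simp only [gradSq, grad, Finset.mul_sum]
    exact Finset.sum_congr rfl fun k _ => Finset.sum_congr rfl fun l _ => by ring
  have hC := H.sum_christoffel_succ_mul α γ hp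
  rw [box, H.inv_warpedMetric α γ hp]
  simp only [Fin.sum_univ_succ, h00, h11, h0 p hp, h1 p hp, H.christoffel_zero_zero_zero α γ hp,
    H.christoffel_succ_zero_zero α γ hp, H.christoffel_zero_succ_succ α γ hp,
    blockMetric_zero_zero, blockMetric_zero_succ, blockMetric_succ_zero, blockMetric_succ_succ,
    zero_mul, Finset.sum_const_zero, add_zero, zero_add, Matrix.smul_apply, smul_eq_mul]
  -- The spatial Hessian of the field is a combination of `hess h V`, `dV ⊗ dV` and `h`, whose
  -- traces are evaluated together in `hsum`.
  have hspatial : ∀ i j : Fin n, σ * pd i (pd j V) (Fin.tail p)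
      - (-(ε * Real.exp (2 * (q (p 0) - γ * V (Fin.tail p)) - 2 * (P (p 0)
        + α * V (Fin.tail p))) * deriv q (p 0) * h (Fin.tail p) i j) * deriv τ (p 0)
      + ∑ k : Fin n, christoffel (warpedMetric ε α γ V h P q) k.succ i.succ j.succ p
        * (σ * pd k V (Fin.tail p)))
      = σ * (pd i (pd j V) (Fin.tail p)
        - ∑ k, christoffel h k i j (Fin.tail p) * pd k V (Fin.tail p))
      + 2 * σ * γ * (pd i V (Fin.tail p) * pd j V (Fin.tail p))
      + (ε * Real.exp (2 * (q (p 0) - γ * V (Fin.tail p)) - 2 * (P (p 0)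
        + α * V (Fin.tail p))) * deriv q (p 0) * deriv τ (p 0)
        - σ * γ * gradSq h V (Fin.tail p)) * h (Fin.tail p) i j := by
    intro i j
    have : ∑ k : Fin n, christoffel (warpedMetric ε α γ V h P q) k.succ i.succ j.succ p
        * (σ * pd k V (Fin.tail p)) = σ * ∑ k : Fin n, christoffel (warpedMetric ε α γ V h P q)
          k.succ i.succ j.succ p * pd k V (Fin.tail p) := by
      rw [Finset.mul_sum]; exact Finset.sum_congr rfl fun k _ => by ring
    rw [this, hC]
    ring
  have htime : ∑ k : Fin n, -(ε * α * Real.exp (2 * (P (p 0) + α * V (Fin.tail p))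
      - 2 * (q (p 0) - γ * V (Fin.tail p))) * grad h V k (Fin.tail p)) * (σ * pd k V (Fin.tail p))
      = -(ε * α * Real.exp (2 * (P (p 0) + α * V (Fin.tail p))
      - 2 * (q (p 0) - γ * V (Fin.tail p))) * σ) * gradSq h V (Fin.tail p) := by
    rw [gradSq, Finset.mul_sum]; exact Finset.sum_congr rfl fun k _ => by ring
  have hsum : ∀ (a b c d : ℝ), ∑ i, ∑ j, d * (h (Fin.tail p))⁻¹ i j *
      (a * (pd i (pd j V) (Fin.tail p)
        - ∑ k, christoffel h k i j (Fin.tail p) * pd k V (Fin.tail p))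
      + b * (pd i V (Fin.tail p) * pd j V (Fin.tail p)) + c * h (Fin.tail p) i j)
      = d * (a * box h V (Fin.tail p) + b * gradSq h V (Fin.tail p) + c * n) := by
    intro a b c d
    rw [← htrace, ← hQ, box]
    simp only [Finset.mul_sum, ← Finset.sum_add_distrib]
    refine Finset.sum_congr rfl fun i _ => Finset.sum_congr rfl fun j _ => ?_
    ring
  simp only [hspatial, hsum, htime]
  linear_combination (σ * α * gradSq h V (Fin.tail p)) * (ε * ε * hE
    + Real.exp (-(2 * (q (p 0) - γ * V (Fin.tail p)))) * H.sign)
    + ε * deriv q (p 0) * deriv τ (p 0) * n * hF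

end IsWarpedData

/-! ### Seed, inflated metric and family as warped metrics. -/

section Forms

variable {n : ℕ} (ε α : ℝ) (V : (Fin n → ℝ) → ℝ) (h : (Fin n → ℝ) → Matrix (Fin n) (Fin n) ℝ)

theorem orthSymMetric_eq_warpedMetric :
    orthSymMetric ε V h = warpedMetric ε 1 1 V h (fun _ => 0) (fun _ => 0) := by
  funext p
  rw [orthSymMetric, warpedMetric]
  ring_nf

theorem inflatedMetric_eq_warpedMetric (N : ℝ) (μ : ℝ → ℝ) :
    inflatedMetric ε α (deltaOf N α) V h μ = warpedMetric ε α (gammaOf N α) V h μ μ := by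
  funext p
  ext i j
  refine Fin.cases ?_ (fun i => ?_) i <;> refine Fin.cases ?_ (fun j => ?_) j <;>
    simp only [inflatedMetric, orthSymMetric, warpedMetric, blockMetric, Matrix.smul_apply,
      Matrix.of_apply, Fin.cases_zero, Fin.cases_succ, smul_eq_mul, mul_zero]
  · rw [mul_left_comm, ← Real.exp_add]; ring_nf
  · rw [← mul_assoc, ← mul_assoc, ← Real.exp_add, ← Real.exp_add, gammaOf, deltaOf]; ring_nf

theorem familyMetric_eq_warpedMetric (N η lam : ℝ) :
    familyMetric N ε η lam α V h = warpedMetric ε α (gammaOf N α) V h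
      (fun y => lam ^ 2 * √η * y) (fun y => √η * y) := by
  funext p
  rw [familyMetric, warpedMetric, ← Real.exp_add]
  ring_nf

end Forms

/-! ### The field equations reduced by the seed equations. -/

section Solutions

variable {n : ℕ} {ε : ℝ} {Ω : Set (Fin n → ℝ)} {J : Set ℝ} {V : (Fin n → ℝ) → ℝ}
  {h : (Fin n → ℝ) → Matrix (Fin n) (Fin n) ℝ} {P q : ℝ → ℝ}

theorem IsSeed.isWarpedData (hs : IsSeed ε 0 Ω V h) (hε : ε * ε = 1) (hΩ : IsOpen Ω)
    (hJ : IsOpen J) (hP : ContDiffOn ℝ ∞ P J) (hq : ContDiffOn ℝ ∞ q J) :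
    IsWarpedData ε Ω J V h P q :=
  ⟨hε, hΩ, hJ, hs.smooth, hs.metric, hP, hq⟩

/-- The `dy²` component of the vacuum equation: with `α = γ = 1` it is this relation times a
nonvanishing factor. -/
theorem IsSeed.box_eq (hs : IsSeed ε 0 Ω V h) (hε : ε * ε = 1) (hΩ : IsOpen Ω)
    {x : Fin n → ℝ} (hx : x ∈ Ω) : box h V x = ((n : ℝ) - 3) * gradSq h V x := by
  have H := hs.isWarpedData hε hΩ isOpen_univ (P := fun _ => 0) (q := fun _ => 0)
    contDiffOn_const contDiffOn_const
  have hp : (Fin.cons 0 x : Fin (n + 1) → ℝ) ∈ slab Set.univ Ω := ⟨trivial, by simpa using hx⟩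
  have := hs.vacuum.einstein _ hp 0 0
  rw [orthSymMetric_eq_warpedMetric, H.ricci_zero_zero 1 1 hp] at this
  simp only [deriv_const', Fin.tail_cons] at this
  have hE := Real.exp_ne_zero (2 * (0 + 1 * V x) - 2 * (0 - 1 * V x))
  have hε0 := H.sign_ne
  have : ε * Real.exp (2 * (0 + 1 * V x) - 2 * (0 - 1 * V x)) *
      (box h V x - ((n : ℝ) - 3) * gradSq h V x) = 0 := by
    linear_combination -this
  simpa [hε0, sub_eq_zero] using this

/-- The spatial vacuum equation, whose multiple of `h` is removed by `box_eq`. -/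
theorem IsSeed.ricci_eq (hs : IsSeed ε 0 Ω V h) (hε : ε * ε = 1) (hΩ : IsOpen Ω)
    {x : Fin n → ℝ} (hx : x ∈ Ω) (i j : Fin n) :
    ricci h i j x = -((n : ℝ) - 3) * hess h V i j x - ((n : ℝ) - 5) * (pd i V x * pd j V x) := by
  have H := hs.isWarpedData hε hΩ isOpen_univ (P := fun _ => 0) (q := fun _ => 0)
    contDiffOn_const contDiffOn_const
  have hp : (Fin.cons 0 x : Fin (n + 1) → ℝ) ∈ slab Set.univ Ω := ⟨trivial, by simpa using hx⟩
  have := hs.vacuum.einstein _ hp i.succ j.succ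
  rw [orthSymMetric_eq_warpedMetric, H.ricci_succ_succ 1 1 hp] at this
  simp only [deriv_const', Fin.tail_cons] at this
  have hb := hs.box_eq hε hΩ hx
  linear_combination this - h x i j * hb

/-- The Einstein-scalar field equations for the warped metrics derived from a seed. -/
theorem isEinsteinScalarSolution_warpedMetric_iff (hn : 3 ≤ n) (hs : IsSeed ε 0 Ω V h)
    (hε : ε * ε = 1) (hΩ : IsOpen Ω) (hJ : IsOpen J) (hP : ContDiffOn ℝ ∞ P J)
    (hq : ContDiffOn ℝ ∞ q J) (κ α σ : ℝ) {τ : ℝ → ℝ} (hτ : ContDiffOn ℝ ∞ τ J) :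
    IsEinsteinScalarSolution κ (fun _ => 0) (warpedMetric ε α (gammaOf ((n : ℝ) + 1) α) V h P q)
      (fun r => σ * V (Fin.tail r) + τ (r 0)) (slab J Ω) ↔
    ∀ y ∈ J, ∀ x ∈ Ω,
      -(n : ℝ) * (deriv (deriv q) y + deriv q y ^ 2 - deriv q y * deriv P y) = κ * deriv τ y ^ 2 ∧
      (∀ j, ((n : ℝ) - 1) * deriv q y * (α * pd j V x) = κ * (deriv τ y * (σ * pd j V x))) ∧
      (∀ i j, ((n : ℝ) - 1) / ((n : ℝ) - 2) * (1 - α ^ 2) * (pd i V x * pd j V x)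
        - ε * Real.exp (2 * (q y - gammaOf ((n : ℝ) + 1) α * V x) - 2 * (P y + α * V x)) * h x i j
          * (deriv (deriv q) y + (n : ℝ) * deriv q y ^ 2 - deriv q y * deriv P y)
        = κ * σ ^ 2 * (pd i V x * pd j V x)) ∧
      deriv (deriv τ) y - deriv P y * deriv τ y + (n : ℝ) * deriv q y * deriv τ y = 0 := by
  have H := hs.isWarpedData hε hΩ hJ hP hq
  have hn2 : (n : ℝ) - 2 ≠ 0 := by
    have : (3 : ℝ) ≤ n := by exact_mod_cast hn
    linarith
  set γ := gammaOf ((n : ℝ) + 1) α with hγ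
  -- This relation is the reason for the choice of `δ`: it makes the terms in the Hessian, in `box h
  -- V` and in `gradSq h V` cancel below.
  have hγ' : ((n : ℝ) - 2) * γ = α + ((n : ℝ) - 3) := by
    have : ((n : ℝ) + 1 - 3) ≠ 0 := by convert hn2 using 1; ring
    rw [hγ, gammaOf]
    field_simp
    ring
  have h00 : ∀ p ∈ slab J Ω, ricci (warpedMetric ε α γ V h P q) 0 0 p =
      -(n : ℝ) * (deriv (deriv q) (p 0) + deriv q (p 0) ^ 2 - deriv q (p 0) * deriv P (p 0)) := by
    intro p hp
    rw [H.ricci_zero_zero α γ hp, hs.box_eq hε hΩ hp.2, hγ']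
    ring
  have hij : ∀ p ∈ slab J Ω, ∀ i j : Fin n,
      ricci (warpedMetric ε α γ V h P q) i.succ j.succ p =
      ((n : ℝ) - 1) / ((n : ℝ) - 2) * (1 - α ^ 2) * (pd i V (Fin.tail p) * pd j V (Fin.tail p))
        - ε * Real.exp (2 * (q (p 0) - γ * V (Fin.tail p)) - 2 * (P (p 0) + α * V (Fin.tail p)))
          * h (Fin.tail p) i j
          * (deriv (deriv q) (p 0) + (n : ℝ) * deriv q (p 0) ^ 2
            - deriv q (p 0) * deriv P (p 0)) := by
    intro p hp i j
    rw [H.ricci_succ_succ α γ hp, hs.ricci_eq hε hΩ hp.2, hs.box_eq hε hΩ hp.2, hγ']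
    have e1 : γ * ((n : ℝ) - 2) = α + ((n : ℝ) - 3) := by rw [← hγ']; ring
    -- The summand `n - 5` cancels its counterpart in `ricci_eq`.
    have e2 : γ ^ 2 * ((n : ℝ) - 2) - α ^ 2 - 2 * α * γ
        = ((n : ℝ) - 1) / ((n : ℝ) - 2) * (1 - α ^ 2) + ((n : ℝ) - 5) := by
      have : γ = (α + ((n : ℝ) - 3)) / ((n : ℝ) - 2) := by rw [← hγ']; field_simp
      rw [this]
      field_simp
      ring
    rw [e1, e2]
    ring
  have hbox : ∀ p ∈ slab J Ω,
      box (warpedMetric ε α γ V h P q) (fun r => σ * V (Fin.tail r) + τ (r 0)) p =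
      ε * Real.exp (-(2 * (P (p 0) + α * V (Fin.tail p)))) *
        (deriv (deriv τ) (p 0) - deriv P (p 0) * deriv τ (p 0)
          + (n : ℝ) * deriv q (p 0) * deriv τ (p 0)) := by
    intro p hp
    rw [H.box_warpedMetric α γ hp σ hτ, hs.box_eq hε hΩ hp.2, hγ']
    ring
  constructor
  · intro hsol y hy x hx
    have hp : (Fin.cons y x : Fin (n + 1) → ℝ) ∈ slab J Ω := ⟨by simpa using hy, by simpa using hx⟩
    refine ⟨?_, fun j => ?_, fun i j => ?_, ?_⟩
    · have := hsol.einstein _ hp 0 0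
      rw [h00 _ hp, H.pd_zero_field hp σ hτ] at this
      simp only [Fin.cons_zero, mul_zero, add_zero] at this
      rw [this]; ring
    · have := hsol.einstein _ hp 0 j.succ
      rw [H.ricci_zero_succ α γ hp, H.pd_zero_field hp σ hτ, H.pd_succ_field hp σ hτ] at this
      simpa only [Fin.cons_zero, Fin.tail_cons, mul_zero, add_zero] using this
    · have := hsol.einstein _ hp i.succ j.succ
      rw [hij _ hp, H.pd_succ_field hp σ hτ, H.pd_succ_field hp σ hτ] at this
      simp only [Fin.cons_zero, Fin.tail_cons, mul_zero, add_zero] at this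
      rw [this]; ring
    · have := hsol.scalar _ hp
      rw [hbox _ hp] at this
      simpa [H.sign_ne, Real.exp_ne_zero] using this
  · intro heq
    refine ⟨H.isMetricOn α γ, ?_, fun p hp i j => ?_, fun p hp => ?_⟩
    · exact (contDiffOn_const.mul (contDiffOn_comp_tail H.smoothV)).add (contDiffOn_comp_zero hτ)
    · obtain ⟨e1, e2, e3, -⟩ := heq _ hp.1 _ hp.2
      rw [mul_zero, add_zero]
      refine Fin.cases ?_ (fun i => ?_) i <;> refine Fin.cases ?_ (fun j => ?_) j
      · rw [h00 _ hp, H.pd_zero_field hp σ hτ, e1]; ring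
      · rw [H.ricci_zero_succ α γ hp, H.pd_zero_field hp σ hτ, H.pd_succ_field hp σ hτ, e2]
      · rw [H.ricci_succ_zero α γ hp, H.pd_zero_field hp σ hτ, H.pd_succ_field hp σ hτ, e2]; ring
      · rw [hij _ hp, H.pd_succ_field hp σ hτ, H.pd_succ_field hp σ hτ, e3]; ring
    · obtain ⟨-, -, -, e4⟩ := heq _ hp.1 _ hp.2
      rw [hbox _ hp, e4]
      simp

end Solutions

/-! ### Algebra of the constants `α`, `σ`, `ρ`. -/

section Constants

variable {κ N lam s : ℝ}

theorem alphaOf_sq (hN : 3 < N) (hlam : lam ^ 2 = N - 1) (hs : s ^ 2 = 1) :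
    alphaOf N lam s ^ 2 = 1 / 2 * ((N - 1) / (N - 2)) := by
  rw [alphaOf, mul_pow, hs, div_pow, hlam, Real.sq_sqrt (by linarith)]
  have : N - 2 ≠ 0 := by linarith
  have h2 : N - 3 + (N - 1) ≠ 0 := by linarith
  field_simp
  ring

theorem sigmaOf_eq (hκ : 0 < κ) (hN : 3 < N) (hlam : lam ^ 2 = N - 1) :
    sigmaOf N κ lam s = s * √(1 / (2 * κ)) := by
  rw [sigmaOf, hlam]
  have : N - 2 ≠ 0 := by linarith
  have h2 : N - 3 + (N - 1) ≠ 0 := by linarith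
  congr 2
  field_simp
  ring

theorem sigmaOf_sq (hκ : 0 < κ) (hN : 3 < N) (hlam : lam ^ 2 = N - 1) (hs : s ^ 2 = 1) :
    sigmaOf N κ lam s ^ 2 = 1 / (2 * κ) := by
  rw [sigmaOf_eq hκ hN hlam, mul_pow, hs, Real.sq_sqrt (by positivity), one_mul]

theorem rhoOf_sq (hκ : 0 < κ) (hN : 3 < N) (hlam : lam ^ 2 = N - 1) :
    κ * rhoOf N κ lam ^ 2 = (N - 1) * (N - 2) := by
  rw [rhoOf, mul_pow, Real.sq_sqrt (div_nonneg (by linarith) hκ.le), hlam]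
  field_simp

/-- This is what the mixed `y`-`x` field equation requires; it is why `α` and `σ` carry the same
sign `s`. -/
theorem alphaOf_mul (hκ : 0 < κ) (hN : 3 < N) (hlam : lam ^ 2 = N - 1) :
    (N - 2) * alphaOf N lam s = κ * sigmaOf N κ lam s * rhoOf N κ lam := by
  have hN2 : 0 < N - 2 := by linarith
  have e1 : N - 3 + (N - 1) = 2 * (N - 2) := by ring
  rw [sigmaOf_eq hκ hN hlam, rhoOf, alphaOf, hlam, e1]
  have h1 : √(1 / (2 * κ)) * √((N - 2) / κ) = √(N - 2) / (√2 * κ) := by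
    rw [← Real.sqrt_mul (by positivity), show 1 / (2 * κ) * ((N - 2) / κ)
      = (N - 2) / (2 * κ ^ 2) by field_simp, Real.sqrt_div hN2.le, Real.sqrt_mul (by norm_num),
      Real.sqrt_sq hκ.le]
  have h2 : √(2 * (N - 2)) = √2 * √(N - 2) := Real.sqrt_mul (by norm_num) _
  have h3 : √(N - 2) * √(N - 2) = N - 2 := Real.mul_self_sqrt hN2.le
  have h4 : √(N - 2) ≠ 0 := (Real.sqrt_pos.2 hN2).ne'
  calc (N - 2) * (s * (lam / √(2 * (N - 2)))) = √(N - 2) * √(N - 2) *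
        (s * (lam / (√2 * √(N - 2)))) := by rw [h2, h3]
    _ = κ * s * lam * (√(N - 2) / (√2 * κ)) := by field_simp
    _ = _ := by rw [← h1]; ring

theorem exists_rhoOf_eq {ρ : ℝ} (hκ : 0 < κ) (hN : 3 < N)
    (hρ : κ * ρ ^ 2 = (N - 1) * (N - 2)) :
    ∃ lam, (lam = √(N - 1) ∨ lam = -√(N - 1)) ∧ ρ = rhoOf N κ lam := by
  have hl : √(N - 1) ^ 2 = N - 1 := Real.sq_sqrt (by linarith)
  have h1 : ρ ^ 2 = rhoOf N κ (√(N - 1)) ^ 2 :=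
    mul_left_cancel₀ hκ.ne' (hρ.trans (rhoOf_sq hκ hN hl).symm)
  rcases sq_eq_sq_iff_eq_or_eq_neg.1 h1 with h | h
  · exact ⟨_, Or.inl rfl, h⟩
  · exact ⟨_, Or.inr rfl, by rw [h, rhoOf, rhoOf, mul_neg]⟩

theorem exists_sigmaOf_eq {σ : ℝ} (hκ : 0 < κ) (hN : 3 < N) (hlam : lam ^ 2 = N - 1)
    (hσ : σ ^ 2 = 1 / (2 * κ)) : ∃ s : ℝ, (s = 1 ∨ s = -1) ∧ σ = sigmaOf N κ lam s := by
  have h1 : σ ^ 2 = √(1 / (2 * κ)) ^ 2 := by rw [hσ, Real.sq_sqrt (by positivity)]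
  rcases sq_eq_sq_iff_eq_or_eq_neg.1 h1 with h | h
  · exact ⟨1, Or.inl rfl, by rw [h, sigmaOf_eq hκ hN hlam, one_mul]⟩
  · exact ⟨-1, Or.inr rfl, by rw [h, sigmaOf_eq hκ hN hlam, neg_one_mul]⟩

end Constants

/-! ### The equation `μ'' = -c μ'²` and its first integral. -/

section Inflation

variable {J : Set ℝ} {μ : ℝ → ℝ}

theorem deriv_deriv_of_deriv_mul_exp {c m : ℝ} (hJ : IsOpen J) (hμ : ContDiffOn ℝ ∞ μ J)
    (h : ∀ y ∈ J, deriv μ y * Real.exp (c * μ y) = m) {y : ℝ} (hy : y ∈ J) :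
    deriv (deriv μ) y = -(c * deriv μ y ^ 2) := by
  have hd : HasDerivAt μ (deriv μ y) y :=
    ((hμ.contDiffAt (hJ.mem_nhds hy)).differentiableAt (by simp)).hasDerivAt
  have heq : deriv μ =ᶠ[nhds y] fun z => m * Real.exp (-(c * μ z)) :=
    Filter.eventually_of_mem (hJ.mem_nhds hy) fun z hz => by
      change deriv μ z = m * Real.exp (-(c * μ z))
      rw [← h z hz, mul_assoc, ← Real.exp_add]; simp
  rw [heq.deriv_eq, (((hd.const_mul c).fun_neg.exp).const_mul m).deriv, ← h y hy]
  have : Real.exp (c * μ y) * Real.exp (-(c * μ y)) = 1 := by rw [← Real.exp_add]; simp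
  linear_combination -(c * deriv μ y ^ 2) * this

/-- The product has zero derivative on an interval; were its constant value zero, `μ'` would vanish
and `μ` would be constant. -/
theorem exists_deriv_mul_exp_eq {c : ℝ} (hJ : IsOpen J) (hJc : J.OrdConnected)
    (hμ : ContDiffOn ℝ ∞ μ J) (hc : ¬ ∃ c, ∀ y ∈ J, μ y = c)
    (h : ∀ y ∈ J, deriv (deriv μ) y = -(c * deriv μ y ^ 2)) :
    ∃ m, m ≠ 0 ∧ ∀ y ∈ J, deriv μ y * Real.exp (c * μ y) = m := by
  have hd : ∀ y ∈ J, HasDerivAt μ (deriv μ y) y := fun y hy =>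
    ((hμ.contDiffAt (hJ.mem_nhds hy)).differentiableAt (by simp)).hasDerivAt
  have hdd : ∀ y ∈ J, HasDerivAt (deriv μ) (deriv (deriv μ) y) y := fun y hy =>
    (((hμ.deriv_of_isOpen (m := ∞) hJ (by simp)).contDiffAt (hJ.mem_nhds hy)).differentiableAt
      (by simp)).hasDerivAt
  have hprod : ∀ y ∈ J, HasDerivAt (fun y => deriv μ y * Real.exp (c * μ y)) 0 y := by
    intro y hy
    have := (hdd y hy).fun_mul ((hd y hy).const_mul c).exp
    have h0 : deriv (deriv μ) y * Real.exp (c * μ y)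
        + deriv μ y * (Real.exp (c * μ y) * (c * deriv μ y)) = 0 := by
      rw [h y hy]; ring
    rwa [h0] at this
  obtain ⟨m, hm⟩ := hJ.exists_is_const_of_deriv_eq_zero hJc.isPreconnected
    (fun y hy => (hprod y hy).differentiableAt.differentiableWithinAt)
    (fun y hy => (hprod y hy).deriv)
  refine ⟨m, ?_, hm⟩
  rintro rfl
  refine hc (hJ.exists_is_const_of_deriv_eq_zero hJc.isPreconnected
    (fun y hy => (hd y hy).differentiableAt.differentiableWithinAt) fun y hy => ?_)
  simpa [Real.exp_ne_zero] using hm y hy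

/-- Rolle's theorem; order-connectedness keeps the critical point inside `J`. -/
theorem injOn_of_deriv_ne_zero (hJc : J.OrdConnected) (hμ : ContDiffOn ℝ ∞ μ J)
    (h : ∀ y ∈ J, deriv μ y ≠ 0) : Set.InjOn μ J := by
  have key : ∀ a ∈ J, ∀ b ∈ J, a < b → μ a ≠ μ b := by
    intro a ha b hb hab heq
    have hsub := hJc.out ha hb
    obtain ⟨c, hc, hc0⟩ := exists_deriv_eq_zero hab (hμ.continuousOn.mono hsub) heq
    exact h c (hsub (Set.Ioo_subset_Icc_self hc)) hc0
  intro a ha b hb heq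
  rcases lt_trichotomy a b with hab | hab | hab
  · exact (key a ha b hb hab heq).elim
  · exact hab
  · exact (key b hb a ha hab heq.symm).elim

end Inflation

/-! ### Changes of the coordinate `y`. -/

section Reparametrization

variable {n : ℕ}

/-- The Jacobian is diagonal with entries `Y', 1, ..., 1`. -/
theorem pullbackMetric_reparam {Y : ℝ → ℝ} {p : Fin (n + 1) → ℝ} (hY : DifferentiableAt ℝ Y (p 0))
    {g : (Fin (n + 1) → ℝ) → Matrix (Fin (n + 1)) (Fin (n + 1)) ℝ} {A : ℝ}
    {B : Matrix (Fin n) (Fin n) ℝ} (hg : g (reparam Y p) = blockMetric A B) :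
    pullbackMetric (reparam Y) g p = blockMetric (deriv Y (p 0) ^ 2 * A) B := by
  have h00 : pd 0 (fun q : Fin (n + 1) → ℝ => reparam Y q 0) p = deriv Y (p 0) :=
    (HasPd.zero_comp_zero hY.hasDerivAt).2
  have h01 : ∀ k : Fin n, pd 0 (fun q : Fin (n + 1) → ℝ => reparam Y q k.succ) p = 0 := fun k =>
    (HasPd.zero_comp_tail (f := fun x => x k) (by fun_prop)).2
  have h10 : ∀ i : Fin n, pd i.succ (fun q : Fin (n + 1) → ℝ => reparam Y q 0) p = 0 := fun i =>
    (HasPd.succ_comp_zero i hY).2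
  have h11 : ∀ i k : Fin n, pd i.succ (fun q : Fin (n + 1) → ℝ => reparam Y q k.succ) p
      = if i = k then 1 else 0 := by
    intro i k
    refine (HasPd.succ_comp_tail (f := fun x => x k) ⟨by fun_prop, ?_⟩).2
    have := (ContinuousLinearMap.proj (R := ℝ) (φ := fun _ : Fin n => ℝ) k).fderiv
      (x := Fin.tail p)
    have h' : fderiv ℝ (fun x : Fin n → ℝ => x k) (Fin.tail p)
      = ContinuousLinearMap.proj (R := ℝ) (φ := fun _ : Fin n => ℝ) k := this
    rw [pd, h']
    simp [Pi.single_apply, eq_comm]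
  ext i j
  refine Fin.cases ?_ (fun i => ?_) i <;> refine Fin.cases ?_ (fun j => ?_) j <;>
    simp [pullbackMetric, Fin.sum_univ_succ, h00, h01, h10, h11, hg, blockMetric]
  exact Or.inl (by ring)

end Reparametrization

section Reparametrization

variable {n : ℕ} {ε : ℝ} {Ω : Set (Fin n → ℝ)} {J : Set ℝ} {V : (Fin n → ℝ) → ℝ}
  {h : (Fin n → ℝ) → Matrix (Fin n) (Fin n) ℝ} {μ : ℝ → ℝ} {α σ ρ α' σ' lam : ℝ}

/-- Since `√η Y = μ`, the spatial blocks agree at once, and the `dy²` blocks agree because `Y'²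
e^{2nμ} = e^{2μ}` is the squared first integral. The constants `α`, `σ` enter only through products
with `V`, hence the alternative `hV`. -/
theorem reexpresses_of_deriv_mul_exp (hJ : IsOpen J) (hJc : J.OrdConnected)
    (hμ : ContDiffOn ℝ ∞ μ J) {η : ℝ} (hη : 0 < η) (hlam : lam ^ 2 = n)
    (hm : ∀ y ∈ J, (deriv μ y * Real.exp (((n : ℝ) - 1) * μ y)) ^ 2 = η)
    (hV : (∀ x ∈ Ω, V x = 0) ∨ (α = α' ∧ σ = σ')) :
    Reexpresses ε Ω V h J μ α σ ρ (fun y => μ y / √η)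
      (familyMetric ((n : ℝ) + 1) ε η lam α' V h) (familyField η σ' ρ V) := by
  have hs : √η ≠ 0 := (Real.sqrt_pos.2 hη).ne'
  have hd : ∀ y ∈ J, DifferentiableAt ℝ μ y := fun y hy =>
    (hμ.contDiffAt (hJ.mem_nhds hy)).differentiableAt (by simp)
  have hne : ∀ y ∈ J, deriv μ y ≠ 0 := by
    intro y hy h0
    have := hm y hy
    rw [h0] at this
    simp at this
    exact hη.ne this
  have hVV : ∀ x ∈ Ω, α * V x = α' * V x ∧ σ * V x = σ' * V x ∧
      gammaOf ((n : ℝ) + 1) α * V x = gammaOf ((n : ℝ) + 1) α' * V x := by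
    intro x hx
    rcases hV with hV | ⟨rfl, rfl⟩
    · simp [hV x hx]
    · exact ⟨rfl, rfl, rfl⟩
  refine ⟨⟨hμ.div_const _, fun y hy => ?_, ?_⟩, fun p hp => ?_, fun p hp => ?_⟩
  · rw [deriv_div_const]
    exact div_ne_zero (hne y hy) hs
  · intro a ha b hb hab
    exact injOn_of_deriv_ne_zero hJc hμ hne ha hb (by simpa [hs] using hab)
  · obtain ⟨e1, e2, e3⟩ := hVV _ hp.2
    have hYd : DifferentiableAt ℝ (fun y => μ y / √η) (p 0) := (hd _ hp.1).div_const _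
    rw [inflatedMetric_eq_warpedMetric, familyMetric_eq_warpedMetric,
      pullbackMetric_reparam hYd (by rw [warpedMetric]), warpedMetric, deriv_div_const]
    simp only [reparam, Fin.cons_zero, Fin.tail_cons]
    rw [← e1, ← e3, mul_div_cancel₀ _ hs]
    congr 1
    have hsq : √η ^ 2 = η := Real.sq_sqrt hη.le
    have hexp : Real.exp (2 * (lam ^ 2 * √η * (μ (p 0) / √η) + α * V (Fin.tail p)))
        = Real.exp (((n : ℝ) - 1) * μ (p 0)) ^ 2
          * Real.exp (2 * (μ (p 0) + α * V (Fin.tail p))) := by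
      rw [← Real.exp_nat_mul, ← Real.exp_add, hlam]
      congr 1
      push_cast
      field_simp
      ring
    rw [hexp, div_pow, hsq]
    have hone : deriv μ (p 0) ^ 2 / η * Real.exp (((n : ℝ) - 1) * μ (p 0)) ^ 2 = 1 := by
      rw [div_mul_eq_mul_div, ← mul_pow, hm _ hp.1, div_self hη.ne']
    linear_combination -(ε * Real.exp (2 * (μ (p 0) + α * V (Fin.tail p)))) * hone
  · obtain ⟨e1, e2, e3⟩ := hVV _ hp.2
    simp only [inflatedField, familyField, reparam, Fin.cons_zero, Fin.tail_cons]
    rw [e2]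
    field_simp

/-- The parameter is recovered from `μ` alone: neither `Y` nor the sign of `lam` occurs in the
conclusion, which yields uniqueness. -/
theorem eq_of_reexpresses (hn : 0 < n) (hε : ε ≠ 0) (hJ : IsOpen J) {x : Fin n → ℝ}
    (hx : x ∈ Ω) (hdet : (h x).det ≠ 0) {η : ℝ} (hη : 0 < η) (hlam : lam ^ 2 = n)
    (hV : (∀ x ∈ Ω, V x = 0) ∨ α = α') {Y : ℝ → ℝ}
    {φ : (Fin (n + 1) → ℝ) → ℝ} (hY : Reexpresses ε Ω V h J μ α σ ρ Y
      (familyMetric ((n : ℝ) + 1) ε η lam α' V h) φ) {y : ℝ} (hy : y ∈ J) :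
    (deriv μ y * Real.exp (((n : ℝ) - 1) * μ y)) ^ 2 = η := by
  have hYd : ∀ y ∈ J, DifferentiableAt ℝ Y y := fun y hy =>
    (hY.coord.smooth.contDiffAt (hJ.mem_nhds hy)).differentiableAt (by simp)
  have hVV : α * V x = α' * V x ∧
      gammaOf ((n : ℝ) + 1) α * V x = gammaOf ((n : ℝ) + 1) α' * V x := by
    rcases hV with hV | rfl
    · simp [hV x hx]
    · exact ⟨rfl, rfl⟩
  obtain ⟨e1, e3⟩ := hVV
  have hmet : ∀ y ∈ J, blockMetric (ε * Real.exp (2 * (μ y + α * V x)))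
      (Real.exp (2 * (μ y - gammaOf ((n : ℝ) + 1) α * V x)) • h x) =
      blockMetric (deriv Y y ^ 2 * (ε * Real.exp (2 * (lam ^ 2 * √η * Y y + α * V x))))
      (Real.exp (2 * (√η * Y y - gammaOf ((n : ℝ) + 1) α * V x)) • h x) := by
    intro y hy
    have hp : (Fin.cons y x : Fin (n + 1) → ℝ) ∈ slab J Ω := ⟨by simpa using hy, by simpa using hx⟩
    have := hY.metric _ hp
    rw [inflatedMetric_eq_warpedMetric, familyMetric_eq_warpedMetric,
      pullbackMetric_reparam (hYd _ hp.1) (by rw [warpedMetric]), warpedMetric] at this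
    simpa only [reparam, Fin.cons_zero, Fin.tail_cons, ← e1, ← e3] using this
  -- One nonzero entry of `h x` suffices to compare the spatial conformal factors.
  obtain ⟨i, j, hij⟩ : ∃ i j, h x i j ≠ 0 := by
    by_contra! hall
    apply hdet
    have h0 : h x = 0 := by ext i j; exact hall i j
    have : Nonempty (Fin n) := ⟨⟨0, hn⟩⟩
    rw [h0, Matrix.det_zero]
  have hYμ : ∀ y ∈ J, μ y = √η * Y y := by
    intro y hy
    have := congrFun (congrFun (hmet y hy) i.succ) j.succ
    simp only [IsWarpedData.blockMetric_succ_succ, Matrix.smul_apply, smul_eq_mul] at this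
    have := Real.exp_injective (mul_right_cancel₀ hij this)
    linarith
  have hdμ : deriv μ y = √η * deriv Y y := by
    have heq : μ =ᶠ[nhds y] fun z => √η * Y z :=
      Filter.eventually_of_mem (hJ.mem_nhds hy) hYμ
    rw [heq.deriv_eq, deriv_const_mul _ (hYd y hy)]
  have h00 := congrFun (congrFun (hmet y hy) 0) 0
  simp only [IsWarpedData.blockMetric_zero_zero] at h00
  have hexp : Real.exp (2 * (lam ^ 2 * √η * Y y + α * V x))
      = Real.exp (((n : ℝ) - 1) * μ y) ^ 2 * Real.exp (2 * (μ y + α * V x)) := by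
    rw [← Real.exp_nat_mul, ← Real.exp_add, hlam, mul_assoc, ← hYμ y hy]
    congr 1
    push_cast
    ring
  rw [hexp] at h00
  have hpos := Real.exp_ne_zero (2 * (μ y + α * V x))
  have hone : deriv Y y ^ 2 * Real.exp (((n : ℝ) - 1) * μ y) ^ 2 = 1 := by
    apply mul_right_cancel₀ (mul_ne_zero hε hpos)
    linear_combination -h00
  rw [hdμ, mul_pow, mul_pow, Real.sq_sqrt hη.le, mul_assoc, hone, mul_one]

end Reparametrization

/-! ### Necessary and sufficient conditions on the constants and on `μ`. -/

section Classification

variable {n : ℕ} {κ ε : ℝ} {Ω : Set (Fin n → ℝ)} {J : Set ℝ} {V : (Fin n → ℝ) → ℝ}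
  {h : (Fin n → ℝ) → Matrix (Fin n) (Fin n) ℝ} {μ : ℝ → ℝ} {α σ ρ : ℝ}

/-- The conditions on the constants of a member of the family. -/
structure AreFamilyConstants (n : ℕ) (κ α σ ρ : ℝ) : Prop where
  mixed : ((n : ℝ) - 1) * α = κ * σ * ρ
  spatial : ((n : ℝ) - 1) / ((n : ℝ) - 2) * (1 - α ^ 2) = κ * σ ^ 2

theorem areFamilyConstants_of_eq {N lam s : ℝ} (hn : 3 ≤ n) (hN : N = (n : ℝ) + 1) (hκ : 0 < κ)
    (hlam : lam ^ 2 = N - 1) (hs : s ^ 2 = 1) :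
    AreFamilyConstants n κ (alphaOf N lam s) (sigmaOf N κ lam s) (rhoOf N κ lam) := by
  have hn3 : (3 : ℝ) ≤ n := by exact_mod_cast hn
  have hN3 : 3 < N := by linarith
  refine ⟨?_, ?_⟩
  · rw [← alphaOf_mul hκ hN3 hlam, hN]; ring
  · rw [alphaOf_sq hN3 hlam hs, sigmaOf_sq hκ hN3 hlam hs, hN]
    have h1 : (n : ℝ) - 2 ≠ 0 := by linarith
    have h2 : (n : ℝ) + 1 - 2 ≠ 0 := by linarith
    field_simp
    ring

/-- Squaring the mixed condition and inserting `κρ² = n(n - 1)` gives a linear system for `α²` and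
`κσ²`, whose solution has `κσ² = 1/2`. The sign `s` is read off from `σ`, and the mixed condition
then determines `α`. -/
theorem AreFamilyConstants.exists_sign {N lam : ℝ} (hc : AreFamilyConstants n κ α σ ρ)
    (hn : 3 ≤ n) (hN : N = (n : ℝ) + 1) (hκ : 0 < κ) (hlam : lam ^ 2 = N - 1)
    (hρ : ρ = rhoOf N κ lam) :
    ∃ s : ℝ, (s = 1 ∨ s = -1) ∧ α = alphaOf N lam s ∧ σ = sigmaOf N κ lam s := by
  have hn3 : (3 : ℝ) ≤ n := by exact_mod_cast hn
  have hN3 : 3 < N := by linarith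
  have hn1 : (n : ℝ) - 1 ≠ 0 := by linarith
  have hn2 : (n : ℝ) - 2 ≠ 0 := by linarith
  have hρ2 := rhoOf_sq hκ hN3 hlam
  rw [← hρ, hN] at hρ2
  have hα : ((n : ℝ) - 1) * α ^ 2 = n * (κ * σ ^ 2) := by
    apply mul_left_cancel₀ hn1
    linear_combination (((n : ℝ) - 1) * α + κ * σ * ρ) * hc.mixed + κ * σ ^ 2 * hρ2
  have hsp : ((n : ℝ) - 1) * (1 - α ^ 2) = ((n : ℝ) - 2) * (κ * σ ^ 2) := by
    rw [← hc.spatial]; field_simp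
  have hσ : σ ^ 2 = 1 / (2 * κ) := by
    rw [eq_div_iff (by positivity)]
    apply mul_left_cancel₀ hn1
    linear_combination -hα - hsp
  obtain ⟨s, hs, hσs⟩ := exists_sigmaOf_eq hκ hN3 hlam hσ
  refine ⟨s, hs, ?_, hσs⟩
  apply mul_left_cancel₀ hn1
  rw [hc.mixed, hσs, hρ, ← alphaOf_mul hκ hN3 hlam, hN]
  ring

theorem isSolution_inflated_iff (hn : 3 ≤ n) (hs : IsSeed ε 0 Ω V h) (hε : ε * ε = 1)
    (hΩ : IsOpen Ω) (hJ : IsOpen J) (hμ : ContDiffOn ℝ ∞ μ J) :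
    IsEinsteinScalarSolution κ (fun _ => 0)
      (inflatedMetric ε α (deltaOf ((n : ℝ) + 1) α) V h μ) (inflatedField σ ρ V μ) (slab J Ω) ↔
    ∀ y ∈ J, ∀ x ∈ Ω,
      -(n : ℝ) * deriv (deriv μ) y = κ * ρ ^ 2 * deriv μ y ^ 2 ∧
      (∀ j, ((n : ℝ) - 1) * α * (deriv μ y * pd j V x) =
        κ * σ * ρ * (deriv μ y * pd j V x)) ∧
      (∀ i j, ((n : ℝ) - 1) / ((n : ℝ) - 2) * (1 - α ^ 2) * (pd i V x * pd j V x)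
        - ε * Real.exp (2 * (μ y - gammaOf ((n : ℝ) + 1) α * V x) - 2 * (μ y + α * V x)) * h x i j
          * (deriv (deriv μ) y + ((n : ℝ) - 1) * deriv μ y ^ 2)
        = κ * σ ^ 2 * (pd i V x * pd j V x)) ∧
      ρ * (deriv (deriv μ) y + ((n : ℝ) - 1) * deriv μ y ^ 2) = 0 := by
  have hτ : ContDiffOn ℝ ∞ (fun y => ρ * μ y) J := contDiffOn_const.mul hμ
  rw [inflatedMetric_eq_warpedMetric]
  refine (isEinsteinScalarSolution_warpedMetric_iff hn hs hε hΩ hJ hμ hμ κ α σ hτ).trans ?_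
  refine forall₂_congr fun y _ => forall₂_congr fun x _ => ?_
  simp only [deriv_const_mul_field']
  refine and_congr (by ring_nf) (and_congr (forall_congr' fun j => by ring_nf)
    (and_congr (forall₂_congr fun i j => by ring_nf) (by ring_nf)))

/-- If the equation failed at `y`, the spatial field equation could be solved for `h x` as a
multiple of `dV ⊗ dV`, which is singular in dimension at least two. No assumption on `V` is needed,
whereas the scalar equation would require `ρ ≠ 0`. -/
theorem deriv_deriv_of_isClassTZero (hn : 3 ≤ n) (hε : ε * ε = 1) (hΩ : IsOpen Ω)
    (hΩc : Ω.Nonempty) (hT : IsClassTZero κ ε (fun _ => 0) Ω V h J μ α σ ρ) {y : ℝ} (hy : y ∈ J) :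
    deriv (deriv μ) y = -(((n : ℝ) - 1) * deriv μ y ^ 2) := by
  obtain ⟨x, hx⟩ := hΩc
  obtain ⟨-, -, e3, -⟩ := (isSolution_inflated_iff hn hT.seed hε hΩ hT.isOpen hT.smooth).1
    hT.solution y hy x hx
  by_contra hne
  have hS : deriv (deriv μ) y + ((n : ℝ) - 1) * deriv μ y ^ 2 ≠ 0 := fun h0 => hne (by linarith)
  apply hT.seed.metric.nondegenerate x hx
  set E := ε * Real.exp (2 * (μ y - gammaOf ((n : ℝ) + 1) α * V x) - 2 * (μ y + α * V x))
    * (deriv (deriv μ) y + ((n : ℝ) - 1) * deriv μ y ^ 2) with hE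
  have hE0 : E ≠ 0 :=
    mul_ne_zero (mul_ne_zero (left_ne_zero_of_mul_eq_one hε) (Real.exp_ne_zero _)) hS
  have hrank : h x = Matrix.vecMulVec (fun i => E⁻¹ * (((n : ℝ) - 1) / ((n : ℝ) - 2) * (1 - α ^ 2)
      - κ * σ ^ 2) * pd i V x) (fun j => pd j V x) := by
    ext i j
    rw [Matrix.vecMulVec_apply]
    apply mul_left_cancel₀ hE0
    have hEi : E * E⁻¹ = 1 := mul_inv_cancel₀ hE0
    linear_combination -e3 i j - (((n : ℝ) - 1) / ((n : ℝ) - 2) * (1 - α ^ 2)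
      - κ * σ ^ 2) * pd i V x * pd j V x * hEi
  have : Nontrivial (Fin n) := Fin.nontrivial_iff_two_le.2 (by omega)
  rw [hrank, Matrix.det_vecMulVec]

theorem isSolution_inflated_of_constants (hn : 3 ≤ n) (hs : IsSeed ε 0 Ω V h) (hε : ε * ε = 1)
    (hΩ : IsOpen Ω) (hJ : IsOpen J) (hμ : ContDiffOn ℝ ∞ μ J)
    (hc : AreFamilyConstants n κ α σ ρ) (hρ : κ * ρ ^ 2 = n * ((n : ℝ) - 1))
    (hμ' : ∀ y ∈ J, deriv (deriv μ) y = -(((n : ℝ) - 1) * deriv μ y ^ 2)) :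
    IsEinsteinScalarSolution κ (fun _ => 0)
      (inflatedMetric ε α (deltaOf ((n : ℝ) + 1) α) V h μ) (inflatedField σ ρ V μ)
      (slab J Ω) := by
  refine (isSolution_inflated_iff hn hs hε hΩ hJ hμ).2 fun y hy x _ => ?_
  rw [hμ' y hy]
  refine ⟨by rw [hρ]; ring, fun j => by rw [hc.mixed], fun i j => ?_, by ring⟩
  rw [hc.spatial]; ring

/-- Since `λ² = n`, here `P = n q` with `q` linear, so `q'' + n q'² - q' P'` vanishes; equivalently,
`Y` is a harmonic coordinate. -/
theorem isSolution_family (hn : 3 ≤ n) (hs : IsSeed ε 0 Ω V h) (hε : ε * ε = 1)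
    (hΩ : IsOpen Ω) {η lam : ℝ} (hη : 0 < η) (hlam : lam ^ 2 = n)
    (hc : AreFamilyConstants n κ α σ ρ) (hρ : κ * ρ ^ 2 = n * ((n : ℝ) - 1)) :
    IsEinsteinScalarSolution κ (fun _ => 0) (familyMetric ((n : ℝ) + 1) ε η lam α V h)
      (familyField η σ ρ V) (slab Set.univ Ω) := by
  have hsq : √η ^ 2 = η := Real.sq_sqrt hη.le
  have hsm : ∀ c : ℝ, ContDiffOn ℝ ∞ (fun y => c * y) Set.univ := fun c =>
    contDiffOn_const.mul contDiffOn_id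
  have hd : ∀ c : ℝ, deriv (fun y : ℝ => c * y) = fun _ => c := fun c => by
    funext y; simp
  rw [familyMetric_eq_warpedMetric]
  refine (isEinsteinScalarSolution_warpedMetric_iff hn hs hε hΩ isOpen_univ (hsm _) (hsm _) κ α σ
    (hsm (ρ * √η))).2 fun y _ x _ => ?_
  simp only [hd, deriv_const', hlam]
  refine ⟨?_, fun j => ?_, fun i j => ?_, by ring⟩
  · rw [mul_pow, hsq]
    linear_combination (n : ℝ) ^ 2 * hsq - η * hρ
  · linear_combination √η * pd j V x * hc.mixed
  · rw [hc.spatial]; ring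

end Classification

/-! ### An explicit inflation function for every `η`. -/

section Realization

variable {k : ℝ}

/-- The inflation function of the family, on the half-line. -/
def logInflation (k a y : ℝ) : ℝ := Real.log (k * y) / a

theorem contDiffOn_logInflation (hk : 0 < k) (a : ℝ) :
    ContDiffOn ℝ ∞ (logInflation k a) (Set.Ioi 0) :=
  ((contDiffOn_const.mul contDiffOn_id).log fun _ hy => (mul_pos hk hy).ne').div_const a

/-- With `a = n - 1` and `k = (n - 1)√η` the first integral takes the value `√η`. -/
theorem deriv_logInflation_mul_exp (hk : 0 < k) {a : ℝ} (ha : a ≠ 0) {y : ℝ} (hy : 0 < y) :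
    deriv (logInflation k a) y * Real.exp (a * logInflation k a y) = k / a := by
  have hd : HasDerivAt (logInflation k a) (k * 1 / (k * y) / a) y :=
    (((hasDerivAt_id y).const_mul k).log (mul_pos hk hy).ne').div_const a
  rw [hd.deriv, logInflation, mul_div_cancel₀ _ ha, Real.exp_log (mul_pos hk hy)]
  field_simp

theorem image_logInflation (hk : 0 < k) {a b : ℝ} (ha : a ≠ 0) (hb : b ≠ 0) :
    (fun y => logInflation k a y / b) '' Set.Ioi 0 = Set.univ := by
  refine Set.eq_univ_of_forall fun t => ⟨Real.exp (t * b * a) / k, div_pos (Real.exp_pos _) hk, ?_⟩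
  simp only [logInflation]
  rw [mul_div_cancel₀ _ hk.ne', Real.log_exp]
  field_simp

theorem exists_isClassTZero {n : ℕ} {κ ε : ℝ} {Ω : Set (Fin n → ℝ)} {V : (Fin n → ℝ) → ℝ}
    {h : (Fin n → ℝ) → Matrix (Fin n) (Fin n) ℝ} {α σ ρ lam : ℝ} (hn : 3 ≤ n)
    (hs : IsSeed ε 0 Ω V h) (hε : ε * ε = 1) (hΩ : IsOpen Ω) {η : ℝ} (hη : 0 < η)
    (hlam : lam ^ 2 = n) (hc : AreFamilyConstants n κ α σ ρ)
    (hρ : κ * ρ ^ 2 = n * ((n : ℝ) - 1)) :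
    ∃ (J : Set ℝ) (μ Y : ℝ → ℝ), IsClassTZero κ ε (fun _ => 0) Ω V h J μ α σ ρ ∧
      Y '' J = Set.univ ∧
      Reexpresses ε Ω V h J μ α σ ρ Y (familyMetric ((n : ℝ) + 1) ε η lam α V h)
        (familyField η σ ρ V) := by
  have hn3 : (3 : ℝ) ≤ n := by exact_mod_cast hn
  have ha : (n : ℝ) - 1 ≠ 0 := by linarith
  have hη' : 0 < √η := Real.sqrt_pos.2 hη
  have hk : 0 < ((n : ℝ) - 1) * √η := mul_pos (by linarith) hη'
  have hμ := contDiffOn_logInflation hk ((n : ℝ) - 1)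
  have hm := fun y (hy : y ∈ Set.Ioi (0 : ℝ)) => deriv_logInflation_mul_exp hk ha hy
  refine ⟨Set.Ioi 0, logInflation (((n : ℝ) - 1) * √η) ((n : ℝ) - 1), _,
    ⟨hs, isOpen_Ioi, Set.ordConnected_Ioi, Set.nonempty_Ioi, hμ, ?_, ?_⟩,
    image_logInflation hk ha hη'.ne',
    reexpresses_of_deriv_mul_exp isOpen_Ioi Set.ordConnected_Ioi hμ hη hlam (fun y hy => ?_)
      (Or.inr ⟨rfl, rfl⟩)⟩
  · rintro ⟨c, hconst⟩
    have h1 := hm 1 (Set.mem_Ioi.2 one_pos)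
    have heq : logInflation (((n : ℝ) - 1) * √η) ((n : ℝ) - 1) =ᶠ[nhds 1] fun _ => c :=
      Filter.eventually_of_mem (isOpen_Ioi.mem_nhds (Set.mem_Ioi.2 one_pos)) hconst
    rw [heq.deriv_eq, deriv_const, zero_mul] at h1
    exact (div_pos hk (by linarith)).ne h1
  · exact isSolution_inflated_of_constants hn hs hε hΩ isOpen_Ioi hμ hc hρ fun y hy =>
      deriv_deriv_of_deriv_mul_exp isOpen_Ioi hμ hm hy
  · rw [hm y hy, mul_div_cancel_left₀ _ ha, Real.sq_sqrt hη.le]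

end Realization

end EinsteinScalar

end

/-! ### The main theorem. -/

theorem corollary3 (n : ℕ) (hn : 3 ≤ n) (N : ℝ) (hN : N = (n : ℝ) + 1)
    (κ : ℝ) (hκ : 0 < κ) (ε : ℝ) (hε : ε = 1 ∨ ε = -1)
    (Ω : Set (Fin n → ℝ)) (hΩ : IsOpen Ω) (hΩc : IsConnected Ω)
    (V : (Fin n → ℝ) → ℝ) (hhat : (Fin n → ℝ) → Matrix (Fin n) (Fin n) ℝ)
    (hseed : EinsteinScalar.IsSeed ε 0 Ω V hhat) :
    -- every member of the family is a solution of the class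
    (∀ η lam s : ℝ, 0 < η → (lam = √(N - 1) ∨ lam = -√(N - 1)) → (s = 1 ∨ s = -1) →
      ∀ α σ ρ : ℝ, α = EinsteinScalar.alphaOf N lam s → σ = EinsteinScalar.sigmaOf N κ lam s →
        ρ = EinsteinScalar.rhoOf N κ lam →
        (α = √(1 / 2 * ((N - 1) / (N - 2))) ∨ α = -√(1 / 2 * ((N - 1) / (N - 2)))) ∧
        σ = s * √((N - 2) / (κ * (N - 3)) * (1 - α ^ 2)) ∧
        σ = s * (1 / √(2 * κ)) ∧
        EinsteinScalar.IsEinsteinScalarSolution κ (fun _ => 0)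
          (EinsteinScalar.familyMetric N ε η lam α V hhat)
          (EinsteinScalar.familyField η σ ρ V) (EinsteinScalar.slab Set.univ Ω) ∧
        ∃ (J : Set ℝ) (μ Y : ℝ → ℝ),
          EinsteinScalar.IsClassTZero κ ε (fun _ => 0) Ω V hhat J μ α σ ρ ∧
          Y '' J = Set.univ ∧
          EinsteinScalar.Reexpresses ε Ω V hhat J μ α σ ρ Y
            (EinsteinScalar.familyMetric N ε η lam α V hhat)
            (EinsteinScalar.familyField η σ ρ V)) ∧
    -- every solution of the class belongs to the family, for exactly one value of the parameter
    (((∀ x ∈ Ω, V x = 0) ∨ ¬ ∃ c, ∀ x ∈ Ω, V x = c) →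
      ∀ (J : Set ℝ) (μ : ℝ → ℝ) (α σ ρ : ℝ),
        EinsteinScalar.IsClassTZero κ ε (fun _ => 0) Ω V hhat J μ α σ ρ →
        ∃! η : ℝ, 0 < η ∧ ∃ (lam s : ℝ) (Y : ℝ → ℝ),
          (lam = √(N - 1) ∨ lam = -√(N - 1)) ∧ (s = 1 ∨ s = -1) ∧
          ρ = EinsteinScalar.rhoOf N κ lam ∧
          ((¬ ∃ c, ∀ x ∈ Ω, V x = c) →
            α = EinsteinScalar.alphaOf N lam s ∧ σ = EinsteinScalar.sigmaOf N κ lam s) ∧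
          EinsteinScalar.Reexpresses ε Ω V hhat J μ α σ ρ Y
            (EinsteinScalar.familyMetric N ε η lam (EinsteinScalar.alphaOf N lam s) V hhat)
            (EinsteinScalar.familyField η (EinsteinScalar.sigmaOf N κ lam s)
              (EinsteinScalar.rhoOf N κ lam) V)) := by
  subst hN
  have hn3 : (3 : ℝ) ≤ n := by exact_mod_cast hn
  have hN3 : (3 : ℝ) < (n : ℝ) + 1 := by linarith
  have hεε : ε * ε = 1 := by rcases hε with rfl | rfl <;> norm_num
  have hlam_sq : ∀ lam : ℝ, (lam = √((n : ℝ) + 1 - 1) ∨ lam = -√((n : ℝ) + 1 - 1)) →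
      lam ^ 2 = (n : ℝ) + 1 - 1 := by
    rintro lam (rfl | rfl)
    · exact Real.sq_sqrt (by linarith)
    · rw [neg_sq]; exact Real.sq_sqrt (by linarith)
  refine ⟨?_, ?_⟩
  · rintro η lam s hη hlam hs α σ ρ rfl rfl rfl
    have hl := hlam_sq lam hlam
    have hln : lam ^ 2 = n := by rw [hl]; ring
    have hs2 : s ^ 2 = 1 := by rcases hs with rfl | rfl <;> norm_num
    have hα := EinsteinScalar.alphaOf_sq hN3 hl hs2
    have hc := EinsteinScalar.areFamilyConstants_of_eq hn rfl hκ hl hs2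
    have hρ : κ * EinsteinScalar.rhoOf ((n : ℝ) + 1) κ lam ^ 2 = n * ((n : ℝ) - 1) := by
      rw [EinsteinScalar.rhoOf_sq hκ hN3 hl]; ring
    refine ⟨?_, ?_, ?_, EinsteinScalar.isSolution_family hn hseed hεε hΩ hη hln hc hρ,
      EinsteinScalar.exists_isClassTZero hn hseed hεε hΩ hη hln hc hρ⟩
    · refine sq_eq_sq_iff_eq_or_eq_neg.1 ?_
      rw [hα, Real.sq_sqrt]
      exact mul_nonneg (by norm_num) (div_nonneg (by linarith) (by linarith))
    · rw [EinsteinScalar.sigmaOf_eq hκ hN3 hl, hα]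
      have h1 : (n : ℝ) + 1 - 2 ≠ 0 := by linarith
      have h2 : (n : ℝ) + 1 - 3 ≠ 0 := by linarith
      congr 2
      field_simp
      ring
    · rw [EinsteinScalar.sigmaOf_eq hκ hN3 hl, Real.sqrt_div zero_le_one, Real.sqrt_one]
  · intro hV J μ α σ ρ hT
    obtain ⟨x₀, hx₀⟩ := hΩc.nonempty
    have hμ' := fun y (hy : y ∈ J) =>
      EinsteinScalar.deriv_deriv_of_isClassTZero hn hεε hΩ hΩc.nonempty hT hy
    obtain ⟨m, hm0, hm⟩ := EinsteinScalar.exists_deriv_mul_exp_eq hT.isOpen hT.interval hT.smooth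
      hT.nonconstant hμ'
    have heqs := (EinsteinScalar.isSolution_inflated_iff hn hT.seed hεε hΩ hT.isOpen hT.smooth).1
      hT.solution
    obtain ⟨y₀, hy₀⟩ := hT.nonempty
    have hd₀ : deriv μ y₀ ≠ 0 := fun h0 => hm0 (by rw [← hm y₀ hy₀, h0, zero_mul])
    -- Insert the equation for `μ''` into the `dy²` equation `-n μ'' = κρ² μ'²` and cancel `μ'²`.
    have hρ : κ * ρ ^ 2 = ((n : ℝ) + 1 - 1) * ((n : ℝ) + 1 - 2) := by
      have e1 := (heqs y₀ hy₀ x₀ hx₀).1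
      rw [hμ' y₀ hy₀] at e1
      apply mul_right_cancel₀ (pow_ne_zero 2 hd₀)
      linear_combination -e1
    obtain ⟨lam, hlam, hρlam⟩ := EinsteinScalar.exists_rhoOf_eq hκ hN3 hρ
    have hl := hlam_sq lam hlam
    have hconst : (¬ ∃ c, ∀ x ∈ Ω, V x = c) → ∃ s : ℝ, (s = 1 ∨ s = -1) ∧
        α = EinsteinScalar.alphaOf ((n : ℝ) + 1) lam s ∧
        σ = EinsteinScalar.sigmaOf ((n : ℝ) + 1) κ lam s := by
      intro hnc
      -- At such a point `dV` can be cancelled from the mixed equation and from the diagonal spatial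
      -- one.
      obtain ⟨x, hx, j, hj⟩ : ∃ x ∈ Ω, ∃ j, EinsteinScalar.pd j V x ≠ 0 := by
        by_contra! hall
        exact hnc (EinsteinScalar.exists_eq_const_of_pd_eq_zero hΩ hΩc.isPreconnected
          hT.seed.smooth hall)
      obtain ⟨-, e2, e3, -⟩ := heqs y₀ hy₀ x hx
      have hS := hμ' y₀ hy₀
      refine EinsteinScalar.AreFamilyConstants.exists_sign (ρ := ρ)
        ⟨mul_right_cancel₀ (mul_ne_zero hd₀ hj) (e2 j), ?_⟩ hn rfl hκ hl hρlam
      apply mul_right_cancel₀ (mul_ne_zero hj hj)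
      have e := e3 j j
      rw [hS, neg_add_cancel, mul_zero, sub_zero] at e
      exact e
    obtain ⟨s, hs, hαs, hVs⟩ : ∃ s : ℝ, (s = 1 ∨ s = -1) ∧
        ((¬ ∃ c, ∀ x ∈ Ω, V x = c) → α = EinsteinScalar.alphaOf ((n : ℝ) + 1) lam s ∧
          σ = EinsteinScalar.sigmaOf ((n : ℝ) + 1) κ lam s) ∧
        ((∀ x ∈ Ω, V x = 0) ∨ (α = EinsteinScalar.alphaOf ((n : ℝ) + 1) lam s ∧
          σ = EinsteinScalar.sigmaOf ((n : ℝ) + 1) κ lam s)) := by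
      rcases hV with hV | hV
      -- For `V ≡ 0` the sign `s` has no effect, so `1` is an arbitrary choice.
      · exact ⟨1, Or.inl rfl, fun hnc => (hnc ⟨0, hV⟩).elim, Or.inl hV⟩
      · obtain ⟨s, hs, hc⟩ := hconst hV
        exact ⟨s, hs, fun _ => hc, Or.inr hc⟩
    -- Only `μ'²` enters the metric, so the sign of `m` is immaterial and `√(m ^ 2) = |m|` is the
    -- right scale for `Y`.
    refine ⟨m ^ 2, ⟨by positivity, lam, s, fun y => μ y / √(m ^ 2), hlam, hs, hρlam, hαs, ?_⟩, ?_⟩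
    · rw [← hρlam]
      exact EinsteinScalar.reexpresses_of_deriv_mul_exp hT.isOpen hT.interval hT.smooth
        (by positivity) (by rw [hl]; ring) (fun y hy => by rw [hm y hy]) hVs
    · rintro η ⟨hη, lam', s', Y, hlam', -, -, hα', hY⟩
      have hV' : (∀ x ∈ Ω, V x = 0) ∨ α = EinsteinScalar.alphaOf ((n : ℝ) + 1) lam' s' :=
        hV.imp_right fun hnc => (hα' hnc).1
      rw [← EinsteinScalar.eq_of_reexpresses (by omega) (left_ne_zero_of_mul_eq_one hεε) hT.isOpen
        hx₀ (hT.seed.metric.nondegenerate x₀ hx₀) hη (by rw [hlam_sq lam' hlam']; ring) hV' hY hy₀,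
        hm y₀ hy₀]
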